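/- Set $\hbar=1$ and let $\lambda,\mu>0$, $\kappa\in\mathbb R$. A system with Hilbert space $L^2(\mathbb R)$ (position $Q$, momentum $P$, coordinate $q$) is coupled to two probes with joint Hilbert space $L^2(\mathbb R^2)$ (coordinates $q_1,q_2$) by the unitary $U=e^{-iH}$ with $H=\lambda QP_1-\mu PQ_2+\tfrac{\lambda\mu}{2}\kappa P_1Q_2$, that is, $$(U\Phi)(q,q_1,q_2)=\Phi\bigl(q+\mu q_2,\;q_1-\lambda q-\tfrac{\lambda\mu}{2}(\kappa+1)q_2,\;q_2\bigr).$$ Let $\sigma$ be an arbitrary density operator on $L^2(\mathbb R^2)$ (the probe state; it may be pure or mixed, entangled or not). After the coupling, $Q_1$ and $P_2$ are measured ideally; the effective joint observable $G=G^{(\lambda,\mu)}$ of the system consists of the bounded operators $G(X\times Y)$, $X,Y\subseteq\mathbb R$ Borel, determined by $$\langle\psi,G(X\times Y)\psi\rangle=\operatorname{tr}\bigl[U(P_\psi\otimes\sigma)U^*\,(I\otimes \mathsf E^{Q_1}(\lambda X)\otimes \mathsf E^{P_2}(\mu Y))\bigr]\qquad(\|\psi\|=1),$$ where $P_\psi$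 is the projection onto $\psi$ and $\mathsf E^{A}$ denotes the spectral measure of $A$. Let $\mathsf E(X)=G(X\times\mathbb R)$ and $\mathsf F(Y)=G(\mathbb R\times Y)$ be its marginals. For a probability measure $m$ on $\mathbb R$ write $(\chi_X*m)(x)=m(\{y: x-y\in X\})$, let $m[2]=\int x^2\,dm(x)\in[0,\infty]$, and let $\operatorname{Var} m\in[0,\infty]$ be the variance of $m$. Then these operators $G(X\times Y)$ exist, and there are probability measures $e=e^{(\lambda,\mu)}$ and $f=f^{(\lambda,\mu)}$ on $\mathbb R$ (the noise distributions) with $$\mathsf E(X)=(\chi_X*e)(Q),\qquad \mathsf F(Y)=(\chi_Y*f)(P)\qquad\text{for all Borel sets }X,Y\subseteq\mathbb R,$$ and any such $e,f$ satisfy $$\operatorname{Var}e\cdot\operatorname{Var}f\ \ge\ \tfrac14\qquad\text{and}\qquad e[2]\cdot f[2]\ \ge\ \tfrac14 .$$ Consequently Heisenberg's error--disturbance (joint measurement error) relation is not violated in any generalized Arthurs--Kelly model: for observables $A,B$ on $\mathbb R$ let $\Delta(A,B)=\sup_\rho \mathcal D_2(p^A_\rho,p^B_\rho)\in[0,\infty]$,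 the supremum over all density operators $\rho$ on $L^2(\mathbb R)$ of the Wasserstein 2-distance between the outcome distributions $p^A_\rho(X)=\operatorname{tr}[\rho A(X)]$ and $p^B_\rho$. Then $$\Delta(\mathsf E,\mathsf E^Q)^2=e[2],\qquad \Delta(\mathsf F,\mathsf E^P)^2=f[2],\qquad \Delta(\mathsf E,\mathsf E^Q)\,\Delta(\mathsf F,\mathsf E^P)\ \ge\ \tfrac12 .$$ -/

import Mathlib

open MeasureTheory ProbabilityTheory Set
open scoped ENNReal FourierTransform InnerProductSpace

noncomputable section

namespace ArthursKelly

/-! ### Hilbert space operators, trace, states -/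

section Trace

variable (H : Type) [NormedAddCommGroup H] [InnerProductSpace ℂ H] [CompleteSpace H]

/-- Index set of a fixed orthonormal basis of the Hilbert space `H`. -/
def BasisIndex : Set H := (exists_hilbertBasis ℂ H).choose

/-- A fixed orthonormal (Hilbert) basis of `H`. -/
def onb : HilbertBasis (BasisIndex H) ℂ H := (exists_hilbertBasis ℂ H).choose_spec.choose

variable {H}

/-- The trace `∑ᵢ ⟨bᵢ, T bᵢ⟩`. It is only applied to products of a density operator and bounded
operators, where the sum converges absolutely and does not depend on the basis. -/
def trace (T : H →L[ℂ] H) : ℂ := ∑' i, ⟪onb H i, T (onb H i)⟫_ℂ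

variable (H) in
/-- A density operator: a positive operator with trace one. -/
structure DensityOperator where
  op : H →L[ℂ] H
  positive : op.IsPositive
  trace_one : HasSum (fun i => ⟪onb H i, op (onb H i)⟫_ℂ) 1

end Trace

/-! ### Wave functions, position and momentum -/

section Waves

variable (V : Type) [NormedAddCommGroup V] [InnerProductSpace ℝ V] [FiniteDimensional ℝ V]
  [MeasurableSpace V] [BorelSpace V]

/-- The Hilbert space of square-integrable wave functions on the configuration space `V`. -/
abbrev L2 : Type := Lp (α := V) ℂ 2 (volume : Measure V)

variable {V}

open Classical in
/-- The operator `g(Q)` of multiplication by an (essentially) bounded measurable function `g` in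
the position representation (and `0` if `g` is not such a function). -/
def posFun (g : V → ℂ) : L2 V →L[ℂ] L2 V :=
  if h : MemLp g ∞ (volume : Measure V) then
    (ContinuousLinearMap.mul ℂ ℂ).holderL volume ∞ 2 2 (h.toLp g)
  else 0

/-- The unitary Fourier transform with kernel `exp (-2πi⟨x, ξ⟩)` on square-integrable functions. -/
def fourierOp : L2 V →L[ℂ] L2 V :=
  (Lp.fourierTransformₗᵢ V ℂ).toContinuousLinearEquiv.toContinuousLinearMap

/-- The inverse Fourier transform on square-integrable functions. -/
def fourierInvOp : L2 V →L[ℂ] L2 V :=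
  (Lp.fourierTransformₗᵢ V ℂ).symm.toContinuousLinearEquiv.toContinuousLinearMap

/-- The operator `g(P)`, where `P = -i∇` is the momentum (`ℏ = 1`). In the normalisation of the
Fourier transform used here, the momentum belonging to the frequency `ξ` is `p = 2πξ`. -/
def momFun (g : V → ℂ) : L2 V →L[ℂ] L2 V :=
  fourierInvOp ∘L posFun (fun ξ => g ((2 * Real.pi) • ξ)) ∘L fourierOp

end Waves

/-- The indicator function of a set, with complex values. -/
def chi {V : Type} (A : Set V) : V → ℂ := A.indicator 1

/-- The ideal position observable (spectral measure of `Q`) of one particle on the line. -/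
def idealPosition (X : Set ℝ) : L2 ℝ →L[ℂ] L2 ℝ := posFun (chi X)

/-- The ideal momentum observable (spectral measure of `P`) of one particle on the line. -/
def idealMomentum (Y : Set ℝ) : L2 ℝ →L[ℂ] L2 ℝ := momFun (chi Y)

/-- The configuration space of the two probes, with coordinates `(q₁, q₂)`. -/
abbrev ProbeConf : Type := EuclideanSpace ℝ (Fin 2)

/-- The configuration space of system and probes, with coordinates `(q, q₁, q₂)`. -/
abbrev TotalConf : Type := EuclideanSpace ℝ (Fin 3)

/-- The spectral measure of the position `Q₁` of probe 1, on the total system. -/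
def probePosition (X : Set ℝ) : L2 TotalConf →L[ℂ] L2 TotalConf :=
  posFun (chi {x : TotalConf | x 1 ∈ X})

/-- The spectral measure of the momentum `P₂` of probe 2, on the total system. -/
def probeMomentum (Y : Set ℝ) : L2 TotalConf →L[ℂ] L2 TotalConf :=
  momFun (chi {p : TotalConf | p 2 ∈ Y})

/-! ### Product states -/

/-- Splitting of the coordinates `(q, q₁, q₂)` into `q` and `(q₁, q₂)`. -/
def splitConf (x : TotalConf) : ℝ × ProbeConf := (x 0, !₂[x 1, x 2])

theorem measurePreserving_splitConf :
    MeasurePreserving splitConf (volume : Measure TotalConf) (volume : Measure (ℝ × ProbeConf)) := by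
  have h1 := PiLp.volume_preserving_ofLp (Fin 3)
  have h2 := volume_preserving_piFinSuccAbove (fun _ : Fin 3 => ℝ) 0
  have h3 : MeasurePreserving (Prod.map (id : ℝ → ℝ) (WithLp.toLp 2 : (Fin 2 → ℝ) → ProbeConf))
      volume volume := (MeasurePreserving.id volume).prod (PiLp.volume_preserving_toLp (Fin 2))
  have h4 : splitConf = Prod.map (id : ℝ → ℝ) (WithLp.toLp 2 : (Fin 2 → ℝ) → ProbeConf) ∘
      (MeasurableEquiv.piFinSuccAbove (fun _ : Fin 3 => ℝ) 0) ∘ WithLp.ofLp := by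
    funext x
    refine Prod.ext rfl ?_
    ext i
    fin_cases i <;> rfl
  rw [h4]
  exact h3.comp (h2.comp h1)

theorem eLpNorm_tensor (ψ : L2 ℝ) (φ : L2 ProbeConf) :
    eLpNorm (fun x : TotalConf => ψ (splitConf x).1 * φ (splitConf x).2) 2 volume =
      eLpNorm ψ 2 volume * eLpNorm φ 2 volume := by
  have hψ := (Lp.aestronglyMeasurable ψ)
  have hφ := (Lp.aestronglyMeasurable φ)
  have hm : AEStronglyMeasurable (fun z : ℝ × ProbeConf => ψ z.1 * φ z.2) volume :=
    hψ.comp_fst.mul hφ.comp_snd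
  have h1 := eLpNorm_comp_measurePreserving (p := 2) hm measurePreserving_splitConf
  have h2 : (fun x : TotalConf => ψ (splitConf x).1 * φ (splitConf x).2) =
      (fun z : ℝ × ProbeConf => ψ z.1 * φ z.2) ∘ splitConf := rfl
  rw [h2, h1]
  simp only [eLpNorm_eq_lintegral_rpow_enorm_toReal two_ne_zero ENNReal.ofNat_ne_top]
  rw [← ENNReal.mul_rpow_of_nonneg _ _ (by positivity), Measure.volume_eq_prod,
    ← lintegral_prod_mul (hψ.enorm.pow_const _) (hφ.enorm.pow_const _)]
  congr 1
  refine lintegral_congr fun z => ?_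
  rw [enorm_mul, ENNReal.mul_rpow_of_nonneg _ _ (by positivity)]

theorem memLp_tensor (ψ : L2 ℝ) (φ : L2 ProbeConf) :
    MemLp (fun x : TotalConf => ψ (splitConf x).1 * φ (splitConf x).2) 2 volume := by
  refine ⟨?_, ?_⟩
  · have hm : AEStronglyMeasurable (fun z : ℝ × ProbeConf => ψ z.1 * φ z.2) volume :=
      (Lp.aestronglyMeasurable ψ).comp_fst.mul (Lp.aestronglyMeasurable φ).comp_snd
    exact hm.comp_measurePreserving measurePreserving_splitConf
  · rw [eLpNorm_tensor]
    exact ENNReal.mul_lt_top (Lp.memLp ψ).2 (Lp.memLp φ).2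

/-- The product wave function `(ψ ⊗ φ)(q, q₁, q₂) = ψ(q) φ(q₁, q₂)`. -/
def tensor (ψ : L2 ℝ) (φ : L2 ProbeConf) : L2 TotalConf := (memLp_tensor ψ φ).toLp _

theorem norm_tensor (ψ : L2 ℝ) (φ : L2 ProbeConf) : ‖tensor ψ φ‖ = ‖ψ‖ * ‖φ‖ := by
  rw [tensor, Lp.norm_toLp, eLpNorm_tensor, ENNReal.toReal_mul, ← Lp.norm_def, ← Lp.norm_def]

theorem tendsto_snd_splitConf :
    Filter.Tendsto (fun x : TotalConf => (splitConf x).2) (ae volume) (ae volume) :=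
  Measure.quasiMeasurePreserving_snd.tendsto_ae.comp
    measurePreserving_splitConf.quasiMeasurePreserving.tendsto_ae

/-- The bounded operator `φ ↦ ψ ⊗ φ`. -/
def tensorLeft (ψ : L2 ℝ) : L2 ProbeConf →L[ℂ] L2 TotalConf :=
  LinearMap.mkContinuous
    { toFun := tensor ψ
      map_add' := fun φ₁ φ₂ => by
        rw [tensor, tensor, tensor, ← MemLp.toLp_add]
        apply MemLp.toLp_congr
        filter_upwards [tendsto_snd_splitConf.eventually (Lp.coeFn_add φ₁ φ₂)] with x hx
        simp only [hx, Pi.add_apply, mul_add]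
      map_smul' := fun c φ => by
        rw [tensor, tensor, RingHom.id_apply, ← MemLp.toLp_const_smul]
        apply MemLp.toLp_congr
        filter_upwards [tendsto_snd_splitConf.eventually (Lp.coeFn_smul c φ)] with x hx
        simp only [hx, Pi.smul_apply, smul_eq_mul, mul_left_comm] }
    ‖ψ‖ (fun φ => (norm_tensor ψ φ).le)

/-- The operator `P_ψ ⊗ σ` on the total system, where `P_ψ` is the projection onto the unit
vector `ψ` of the system. -/
def productState (ψ : L2 ℝ) (σ : L2 ProbeConf →L[ℂ] L2 ProbeConf) :
    L2 TotalConf →L[ℂ] L2 TotalConf :=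
  tensorLeft ψ ∘L σ ∘L (tensorLeft ψ).adjoint

/-! ### The coupling -/

/-- The flow on configuration space that is induced by the interaction Hamiltonian
`H = λ Q P₁ - μ P Q₂ + (λμκ/2) P₁ Q₂`. -/
def couplingFlow (lam mu kap t : ℝ) (x : TotalConf) : TotalConf :=
  !₂[x 0 + t * mu * x 2,
    x 1 - t * lam * x 0 - (t ^ 2 * (lam * mu / 2) + t * (lam * mu / 2 * kap)) * x 2,
    x 2]

theorem couplingFlow_zero (lam mu kap : ℝ) (x : TotalConf) :
    couplingFlow lam mu kap 0 x = x := by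
  ext i; fin_cases i <;> simp [couplingFlow]

theorem couplingFlow_add (lam mu kap s t : ℝ) (x : TotalConf) :
    couplingFlow lam mu kap (s + t) x = couplingFlow lam mu kap s (couplingFlow lam mu kap t x) := by
  ext i; fin_cases i <;> simp [couplingFlow] <;> ring

/-- The matrix of the linear map `couplingFlow lam mu kap t`. -/
def couplingMatrix (lam mu kap t : ℝ) : Matrix (Fin 3) (Fin 3) ℝ :=
  !![1, 0, t * mu;
    -(t * lam), 1, -(t ^ 2 * (lam * mu / 2) + t * (lam * mu / 2 * kap));
    0, 0, 1]

theorem couplingFlow_eq_toLpLin (lam mu kap t : ℝ) :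
    couplingFlow lam mu kap t = Matrix.toLpLin 2 2 (couplingMatrix lam mu kap t) := by
  funext x
  ext i
  fin_cases i <;>
    simp [couplingFlow, couplingMatrix, Matrix.toLpLin_apply, dotProduct, Fin.sum_univ_three]
  ring

/-- The interaction Hamiltonian `H = λ Q P₁ - μ P Q₂ + (λμκ/2) P₁ Q₂`, with `P = -i ∂/∂q` and
`P₁ = -i ∂/∂q₁`, as a differential operator. -/
def hamiltonian (lam mu kap : ℝ) (Φ : TotalConf → ℂ) (x : TotalConf) : ℂ :=
  lam * x 0 * (-Complex.I * fderiv ℝ Φ x (EuclideanSpace.single 1 1))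
    - mu * x 2 * (-Complex.I * fderiv ℝ Φ x (EuclideanSpace.single 0 1))
    + lam * mu / 2 * kap * x 2 * (-Complex.I * fderiv ℝ Φ x (EuclideanSpace.single 1 1))

/-- The functions `Φ_t = Φ ∘ couplingFlow t` solve the Schrödinger equation `dΦ_t/dt = -i H Φ_t`
with initial value `Φ`: composition with the flow is the unitary group `exp(-itH)`. -/
theorem schrodinger_couplingFlow (lam mu kap t : ℝ) (Φ : TotalConf → ℂ) (hΦ : Differentiable ℝ Φ)
    (x : TotalConf) :
    HasDerivAt (fun s => Φ (couplingFlow lam mu kap s x))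
      (-Complex.I * hamiltonian lam mu kap (fun y => Φ (couplingFlow lam mu kap t y)) x) t := by
  set L : TotalConf →L[ℝ] TotalConf :=
    (Matrix.toLpLin 2 2 (couplingMatrix lam mu kap t)).toContinuousLinearMap with hL
  have hLf : ∀ y, couplingFlow lam mu kap t y = L y := fun y => by
    rw [couplingFlow_eq_toLpLin, hL]; rfl
  set v : TotalConf := (mu * x 2) • EuclideanSpace.single 0 1
    - (lam * x 0 + lam * mu / 2 * kap * x 2) • EuclideanSpace.single 1 1 with hv
  have hcurve : HasDerivAt (fun s => couplingFlow lam mu kap s x) (L v) t := by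
    have h1 : (fun s => couplingFlow lam mu kap s x) = fun s : ℝ =>
        x + s • v + s ^ 2 • ((-(lam * mu / 2 * x 2)) • (EuclideanSpace.single 1 1 : TotalConf)) := by
      funext s
      ext i
      fin_cases i <;> simp [couplingFlow, hv]
      all_goals ring
    have h2 : L v = (1 : ℝ) • v + (((2 : ℕ) : ℝ) * t ^ (2 - 1)) •
        ((-(lam * mu / 2 * x 2)) • (EuclideanSpace.single 1 1 : TotalConf)) := by
      rw [← hLf]
      ext i
      fin_cases i <;> simp [couplingFlow, hv]
      all_goals ring
    rw [h1, h2]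
    exact (((hasDerivAt_id t).smul_const v).const_add x).add ((hasDerivAt_pow 2 t).smul_const _)
  have hΦx : HasFDerivAt Φ (fderiv ℝ Φ (couplingFlow lam mu kap t x))
      (couplingFlow lam mu kap t x) := (hΦ _).hasFDerivAt
  have h3 := hΦx.comp_hasDerivAt t hcurve
  have h4 : fderiv ℝ (fun y => Φ (couplingFlow lam mu kap t y)) x =
      (fderiv ℝ Φ (couplingFlow lam mu kap t x)).comp L := by
    have h5 : HasFDerivAt (couplingFlow lam mu kap t) L x := by
      rw [show couplingFlow lam mu kap t = L from funext hLf]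
      exact L.hasFDerivAt
    exact (hΦx.comp x h5).fderiv
  refine h3.congr_deriv ?_
  symm
  simp only [hamiltonian, h4, hv]
  simp only [ContinuousLinearMap.comp_apply, map_sub, map_smul, Complex.real_smul]
  push_cast
  linear_combination (-(lam * x 0 + lam * mu / 2 * kap * x 2) *
    fderiv ℝ Φ (couplingFlow lam mu kap t x) (L (EuclideanSpace.single 1 1))
    + mu * x 2 * fderiv ℝ Φ (couplingFlow lam mu kap t x) (L (EuclideanSpace.single 0 1)))
    * (-Complex.I_mul_I)

theorem measurePreserving_couplingFlow (lam mu kap t : ℝ) :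
    MeasurePreserving (couplingFlow lam mu kap t) (volume : Measure TotalConf) volume := by
  have hdet : LinearMap.det (Matrix.toLpLin 2 2 (couplingMatrix lam mu kap t)) = 1 := by
    rw [LinearMap.det_toLpLin, couplingMatrix, Matrix.det_fin_three]
    simp
  rw [couplingFlow_eq_toLpLin]
  refine ⟨(LinearMap.continuous_of_finiteDimensional _).measurable, ?_⟩
  rw [Measure.map_linearMap_addHaar_eq_smul_addHaar _ (by rw [hdet]; exact one_ne_zero), hdet]
  simp

/-- The unitary coupling `U = exp(-iH)` of the system with the probes:
`(U Φ)(q, q₁, q₂) = Φ(q + μ q₂, q₁ - λ q - (λμ/2)(κ + 1) q₂, q₂)`. -/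
def coupling (lam mu kap : ℝ) : L2 TotalConf →L[ℂ] L2 TotalConf :=
  (Lp.compMeasurePreservingₗᵢ ℂ (couplingFlow lam mu kap 1)
    (measurePreserving_couplingFlow lam mu kap 1)).toContinuousLinearMap

/-! ### The measured observable and its noise -/

/-- `G X Y` is the effect `G(X × Y)` of the phase space observable that the generalized
Arthurs-Kelly model measures on the system if the probes are prepared in the state `σ`:
`⟨ψ, G(X × Y) ψ⟩ = tr[U (P_ψ ⊗ σ) U* (I ⊗ E^{Q₁}(λX) ⊗ E^{P₂}(μY))]`
for all system states `ψ` and all Borel sets `X`, `Y` of rescaled pointer readings. -/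
def IsEffectiveObservable (lam mu kap : ℝ) (σ : DensityOperator (L2 ProbeConf))
    (G : Set ℝ → Set ℝ → (L2 ℝ →L[ℂ] L2 ℝ)) : Prop :=
  ∀ X Y : Set ℝ, MeasurableSet X → MeasurableSet Y → ∀ ψ : L2 ℝ, ‖ψ‖ = 1 →
    ⟪ψ, G X Y ψ⟫_ℂ =
      trace ((coupling lam mu kap ∘L productState ψ σ.op ∘L (coupling lam mu kap).adjoint) ∘L
        (probePosition ((fun x => lam * x) '' X) ∘L probeMomentum ((fun y => mu * y) '' Y)))

/-- The convolution `(χ_X * m)(x) = ∫ χ_X(x - y) dm(y)` of an indicator function with a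
probability measure. -/
def smear (m : Measure ℝ) (X : Set ℝ) : ℝ → ℂ := fun x => (m.real {y | x - y ∈ X} : ℂ)

/-- `e` is the noise distribution of the approximate position observable `E`:
`E(X) = (χ_X * e)(Q)`. -/
def IsPositionNoise (E : Set ℝ → (L2 ℝ →L[ℂ] L2 ℝ)) (e : Measure ℝ) : Prop :=
  IsProbabilityMeasure e ∧ ∀ X, MeasurableSet X → E X = posFun (smear e X)

/-- `f` is the noise distribution of the approximate momentum observable `F`:
`F(Y) = (χ_Y * f)(P)`. -/
def IsMomentumNoise (F : Set ℝ → (L2 ℝ →L[ℂ] L2 ℝ)) (f : Measure ℝ) : Prop :=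
  IsProbabilityMeasure f ∧ ∀ Y, MeasurableSet Y → F Y = momFun (smear f Y)

/-- The second moment `m[2] = ∫ x² dm(x)`, possibly infinite. -/
def secondMoment (m : Measure ℝ) : ℝ≥0∞ := ∫⁻ x, ENNReal.ofReal (x ^ 2) ∂m

/-! ### Operational error -/

/-- The Wasserstein 2-distance of two probability measures on the line, possibly infinite. -/
def wasserstein (α β : Measure ℝ) : ℝ≥0∞ :=
  ⨅ (γ : Measure (ℝ × ℝ)) (_ : γ.map Prod.fst = α ∧ γ.map Prod.snd = β),
    (∫⁻ z, ENNReal.ofReal (|z.1 - z.2| ^ 2) ∂γ) ^ (1 / 2 : ℝ)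

/-- `α` is the distribution of the outcomes of the observable `A` in the state `ρ`. -/
def IsOutcomeLaw (A : Set ℝ → (L2 ℝ →L[ℂ] L2 ℝ)) (ρ : DensityOperator (L2 ℝ))
    (α : Measure ℝ) : Prop :=
  IsProbabilityMeasure α ∧ ∀ X, MeasurableSet X → trace (ρ.op ∘L A X) = (α.real X : ℂ)

/-- The error `Δ(A, B)` of an observable `A` as an approximation of an observable `B`: the
Wasserstein 2-distance of their outcome distributions, maximised over all states. -/
def observableError (A B : Set ℝ → (L2 ℝ →L[ℂ] L2 ℝ)) : ℝ≥0∞ :=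
  ⨆ (ρ : DensityOperator (L2 ℝ)) (α : Measure ℝ) (β : Measure ℝ)
    (_ : IsOutcomeLaw A ρ α ∧ IsOutcomeLaw B ρ β), wasserstein α β

end ArthursKelly

end

/-!
In the Heisenberg picture the coupling adds to the position of the system a linear form of the probe
positions, `Q₁ / λ ↦ Q + ⟨u, (q₁, q₂)⟩`, and to its momentum a linear form of the probe momenta,
`P₂ / μ ↦ P + ⟨v, (p₁, p₂)⟩`. System and probe are independent before the coupling, so both
marginals are convolutions of the ideal distributions with a noise that depends only on the probe
state, and the noises are unique because a characteristic function has no zeros near the origin.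

As the unitary coupling makes the two pointers commute while `Q` and `P` do not, necessarily
`⟨u, v⟩ = -1`: up to the sign, the noises are themselves canonically conjugate, and they obey the
uncertainty relation in the probe state. It is proved in a translation form that requires no
domains of unbounded operators: translating a wave function by `t v` moves the mean of `⟨u, q⟩` by
`t ⟨u, v⟩`, but moves the wave function, up to a phase, by at most `|t|` times the standard
deviation of `⟨v, p⟩`. Mixed states are treated as ensembles of pure states, by the Cauchy-Schwarz
inequality.

The independent coupling of the ideal outcome and the noise shows that the error is at most the
root of the second moment of the noise; states in which the ideal outcome is almost sharp show that
it is no smaller.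
-/

noncomputable section

namespace ArthursKelly

section Trace

variable {H : Type} [NormedAddCommGroup H] [InnerProductSpace ℂ H] [CompleteSpace H]
  {ι : Type*}

/-- `ρ = ∑ᵢ |φᵢ⟩⟨φᵢ|`: the density operator `ρ` describes the mixture of the pure states `φᵢ`, where
`‖φᵢ‖²` is the weight of the normalized vector `φᵢ / ‖φᵢ‖`. -/
structure DensityOperator.IsEnsemble (ρ : DensityOperator H) (φ : ι → H) : Prop where
  hasSum_norm_sq : HasSum (fun i => ‖φ i‖ ^ 2) 1
  hasSum_apply : ∀ x, HasSum (fun i => ⟪φ i, x⟫_ℂ • φ i) (ρ.op x)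

theorem DensityOperator.isEnsemble_sqrt (ρ : DensityOperator H) :
    ρ.IsEnsemble fun i => CFC.sqrt ρ.op (onb H i) := by
  set S : H →L[ℂ] H := CFC.sqrt ρ.op
  have hSS : ∀ x, S (S x) = ρ.op x := fun x => congrArg (fun T : H →L[ℂ] H => T x)
    (CFC.sqrt_mul_sqrt_self ρ.op ((ContinuousLinearMap.nonneg_iff_isPositive _).2 ρ.positive))
  have hS : ∀ x y, ⟪S x, y⟫_ℂ = ⟪x, S y⟫_ℂ :=
    ((ContinuousLinearMap.nonneg_iff_isPositive _).1 (CFC.sqrt_nonneg ρ.op)).isSymmetric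
  refine ⟨?_, fun x => ?_⟩
  · have h : ∀ i, ⟪onb H i, ρ.op (onb H i)⟫_ℂ = ((‖S (onb H i)‖ ^ 2 : ℝ) : ℂ) := fun i => by
      rw [← hSS, ← hS, inner_self_eq_norm_sq_to_K, Complex.ofReal_pow]
      rfl
    exact Complex.hasSum_ofReal.1 (by simpa only [h, Complex.ofReal_one] using ρ.trace_one)
  · simpa only [hSS, map_smul, (onb H).repr_apply_apply, ← hS] using
      ((onb H).hasSum_repr (S x)).mapL S

theorem DensityOperator.IsEnsemble.restrict_support {ρ : DensityOperator H} {φ : ι → H}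
    (h : ρ.IsEnsemble φ) : ρ.IsEnsemble fun i : Function.support φ => φ i := by
  refine ⟨(hasSum_subtype_iff_of_support_subset (f := fun i => ‖φ i‖ ^ 2) fun i hi => ?_).2
    h.hasSum_norm_sq, fun x => (hasSum_subtype_iff_of_support_subset
      (f := fun i => ⟪φ i, x⟫_ℂ • φ i) fun i hi => ?_).2 (h.hasSum_apply x)⟩
  all_goals
    contrapose! hi
    simp [Function.notMem_support.1 hi]

theorem DensityOperator.exists_isEnsemble (ρ : DensityOperator H) :
    ∃ (ι : Type) (_ : Countable ι) (φ : ι → H), ρ.IsEnsemble φ := by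
  have h := ρ.isEnsemble_sqrt
  refine ⟨_, Set.Countable.to_subtype ?_, _, h.restrict_support⟩
  refine h.hasSum_norm_sq.summable.countable_support.mono fun i hi => ?_
  simpa using hi

theorem hasSum_norm_inner_onb_sq (x : H) :
    HasSum (fun n => ‖⟪onb H n, x⟫_ℂ‖ ^ 2) (‖x‖ ^ 2) := by
  have h := (onb H).hasSum_inner_mul_inner x x
  have h2 : ∀ n, ⟪x, onb H n⟫_ℂ * ⟪onb H n, x⟫_ℂ = ((‖⟪onb H n, x⟫_ℂ‖ ^ 2 : ℝ) : ℂ) :=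
    fun n => by
      rw [← inner_conj_symm x, RCLike.conj_mul, Complex.ofReal_pow]
      rfl
  simp only [h2, inner_self_eq_norm_sq_to_K] at h
  exact Complex.hasSum_ofReal.1 (by simpa using h)

theorem summable_norm_inner_onb_sq {u : ι → H} (hu : Summable fun i => ‖u i‖ ^ 2) :
    Summable fun p : ι × BasisIndex H => ‖⟪onb H p.2, u p.1⟫_ℂ‖ ^ 2 := by
  rw [summable_prod_of_nonneg fun p => by positivity]
  refine ⟨fun i => (hasSum_norm_inner_onb_sq (u i)).summable, ?_⟩
  simpa only [(hasSum_norm_inner_onb_sq _).tsum_eq] using hu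

theorem summable_inner_mul_inner {u v : ι → H} (hu : Summable fun i => ‖u i‖ ^ 2)
    (hv : Summable fun i => ‖v i‖ ^ 2) :
    Summable fun p : ι × BasisIndex H => ⟪v p.1, onb H p.2⟫_ℂ * ⟪onb H p.2, u p.1⟫_ℂ := by
  refine Summable.of_norm_bounded
    ((summable_norm_inner_onb_sq hv).add (summable_norm_inner_onb_sq hu)) fun p => ?_
  rw [norm_mul, norm_inner_symm]
  nlinarith [two_mul_le_add_sq ‖⟪onb H p.2, v p.1⟫_ℂ‖ ‖⟪onb H p.2, u p.1⟫_ℂ‖,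
    sq_nonneg ‖⟪onb H p.2, v p.1⟫_ℂ‖, sq_nonneg ‖⟪onb H p.2, u p.1⟫_ℂ‖]

theorem hasSum_trace {T : H →L[ℂ] H} {u v : ι → H} (hu : Summable fun i => ‖u i‖ ^ 2)
    (hv : Summable fun i => ‖v i‖ ^ 2) (hT : ∀ x, HasSum (fun i => ⟪v i, x⟫_ℂ • u i) (T x)) :
    HasSum (fun i => ⟪v i, u i⟫_ℂ) (trace T) := by
  have hsum := summable_inner_mul_inner hu hv
  have hdiag : ∀ n, ⟪onb H n, T (onb H n)⟫_ℂ = ∑' i, ⟪v i, onb H n⟫_ℂ * ⟪onb H n, u i⟫_ℂ :=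
    fun n => by
      have h := (hT (onb H n)).mapL (innerSL ℂ (onb H n))
      simp only [innerSL_apply_apply, inner_smul_right] at h
      exact h.tsum_eq.symm
  have htrace : trace T = ∑' p : ι × BasisIndex H, ⟪v p.1, onb H p.2⟫_ℂ * ⟪onb H p.2, u p.1⟫_ℂ := by
    rw [trace, hsum.tsum_prod, ← Summable.tsum_comm (f := fun i n =>
      ⟪v i, onb H n⟫_ℂ * ⟪onb H n, u i⟫_ℂ) hsum]
    exact tsum_congr hdiag
  have hrow : ∀ i, HasSum (fun n => ⟪v i, onb H n⟫_ℂ * ⟪onb H n, u i⟫_ℂ) ⟪v i, u i⟫_ℂ :=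
    fun i => (onb H).hasSum_inner_mul_inner _ _
  rw [htrace]
  exact hsum.hasSum.prod_fiberwise hrow

theorem summable_norm_map_sq {E F : Type*} [NormedAddCommGroup E] [NormedAddCommGroup F]
    {𝕜 : Type*} [NontriviallyNormedField 𝕜] [NormedSpace 𝕜 E] [NormedSpace 𝕜 F] {φ : ι → E}
    (hφ : Summable fun i => ‖φ i‖ ^ 2) (A : E →L[𝕜] F) : Summable fun i => ‖A (φ i)‖ ^ 2 := by
  refine Summable.of_nonneg_of_le (fun i => by positivity) (fun i => ?_) (hφ.mul_left (‖A‖ ^ 2))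
  rw [← mul_pow]
  gcongr
  exact A.le_opNorm _

theorem DensityOperator.IsEnsemble.hasSum_trace_conj_comp {ρ : DensityOperator H} {φ : ι → H}
    (h : ρ.IsEnsemble φ) {K : Type} [NormedAddCommGroup K] [InnerProductSpace ℂ K]
    [CompleteSpace K] (A : H →L[ℂ] K) (B : K →L[ℂ] K) :
    HasSum (fun i => ⟪A (φ i), B (A (φ i))⟫_ℂ) (trace ((A ∘L ρ.op ∘L A.adjoint) ∘L B)) := by
  have hφ := h.hasSum_norm_sq.summable
  have htr := hasSum_trace (T := (A ∘L ρ.op ∘L A.adjoint) ∘L B) (u := fun i => A (φ i))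
    (v := fun i => (B.adjoint ∘L A) (φ i)) (summable_norm_map_sq hφ A)
    (summable_norm_map_sq hφ _) (fun x => by
      simpa [ContinuousLinearMap.adjoint_inner_left, ContinuousLinearMap.adjoint_inner_right]
        using (h.hasSum_apply (A.adjoint (B x))).mapL A)
  simpa [ContinuousLinearMap.adjoint_inner_left] using htr

theorem DensityOperator.IsEnsemble.hasSum_trace_comp {ρ : DensityOperator H} {φ : ι → H}
    (h : ρ.IsEnsemble φ) (B : H →L[ℂ] H) :
    HasSum (fun i => ⟪φ i, B (φ i)⟫_ℂ) (trace (ρ.op ∘L B)) := by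
  simpa [ContinuousLinearMap.adjoint_id] using
    h.hasSum_trace_conj_comp (ContinuousLinearMap.id ℂ H) B

theorem DensityOperator.IsEnsemble.tsum_enorm_sq {ρ : DensityOperator H} {φ : ι → H}
    (h : ρ.IsEnsemble φ) : ∑' i, ‖φ i‖ₑ ^ 2 = 1 := by
  rw [← ENNReal.ofReal_one, ← h.hasSum_norm_sq.tsum_eq,
    ENNReal.ofReal_tsum_of_nonneg (fun i => by positivity) h.hasSum_norm_sq.summable]
  simp only [ENNReal.ofReal_pow (norm_nonneg _), ofReal_norm]

/-- The pure state `|ψ⟩⟨ψ|` given by a unit vector `ψ`. -/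
def pureState (ψ : H) (hψ : ‖ψ‖ = 1) : DensityOperator H where
  op := InnerProductSpace.rankOne ℂ ψ ψ
  positive := InnerProductSpace.isPositive_rankOne_self ψ
  trace_one := by
    have h := (onb H).hasSum_inner_mul_inner ψ ψ
    rw [inner_self_eq_norm_sq_to_K, hψ] at h
    simpa [InnerProductSpace.rankOne_apply, inner_smul_right] using h

theorem isEnsemble_pureState (ψ : H) (hψ : ‖ψ‖ = 1) :
    (pureState ψ hψ).IsEnsemble fun _ : Unit => ψ where
  hasSum_norm_sq := by simp [hψ]
  hasSum_apply x := by simp [pureState]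

theorem trace_pureState_comp (ψ : H) (hψ : ‖ψ‖ = 1) (B : H →L[ℂ] H) :
    trace ((pureState ψ hψ).op ∘L B) = ⟪ψ, B ψ⟫_ℂ := by
  simpa using ((isEnsemble_pureState ψ hψ).hasSum_trace_comp B).unique (hasSum_fintype _)

end Trace

section QuadraticForm

variable {H : Type*} [NormedAddCommGroup H] [InnerProductSpace ℂ H] {A B : H →L[ℂ] H}

theorem eq_of_forall_inner_self_eq (h : ∀ ψ, ⟪ψ, A ψ⟫_ℂ = ⟪ψ, B ψ⟫_ℂ) : A = B := by
  refine ContinuousLinearMap.coe_injective ((ext_inner_map _ _).1 fun ψ => ?_)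
  rw [← inner_conj_symm, ← inner_conj_symm (B.toLinearMap ψ)]
  exact congrArg _ (h ψ)

theorem eq_of_forall_unit_inner_self_eq (h : ∀ ψ, ‖ψ‖ = 1 → ⟪ψ, A ψ⟫_ℂ = ⟪ψ, B ψ⟫_ℂ) :
    A = B := by
  refine eq_of_forall_inner_self_eq fun ψ => ?_
  rcases eq_or_ne ψ 0 with rfl | hψ
  · simp
  · have hn : (‖ψ‖ : ℂ) ≠ 0 := by exact_mod_cast norm_ne_zero_iff.2 hψ
    simpa [inner_smul_left, inner_smul_right, hn] using h ((‖ψ‖ : ℂ)⁻¹ • ψ) (norm_smul_inv_norm hψ)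

end QuadraticForm

section Laws

theorem norm_chi_le_one {X : Type} (A : Set X) (x : X) : ‖chi A x‖ ≤ 1 := by
  by_cases h : x ∈ A <;> simp [chi, h]

theorem map_withDensity_comp {α β : Type*} [MeasurableSpace α] [MeasurableSpace β]
    {μ : Measure α} {ν : Measure β} {T : α → β} (hT : MeasurePreserving T μ ν)
    {f : α → ℝ≥0∞} {g : β → ℝ≥0∞} (hg : AEMeasurable g ν) (h : f =ᵐ[μ] g ∘ T) :
    (μ.withDensity f).map T = ν.withDensity g := by
  ext A hA
  have hgA : AEMeasurable g ((μ.restrict (T ⁻¹' A)).map T) := by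
    rw [(hT.restrict_preimage hA).map_eq]
    exact hg.restrict
  rw [Measure.map_apply hT.measurable hA, withDensity_apply _ hA,
    withDensity_apply _ (hT.measurable hA), lintegral_congr_ae (ae_restrict_of_ae h),
    ← (hT.restrict_preimage hA).map_eq, lintegral_map' hgA hT.measurable.aemeasurable]
  rfl

variable {V : Type} [NormedAddCommGroup V] [InnerProductSpace ℝ V] [FiniteDimensional ℝ V]
  [MeasurableSpace V] [BorelSpace V] {g : V → ℂ} {A : Set V}

theorem coeFn_posFun (hg : MemLp g ∞ (volume : Measure V)) (ψ : L2 V) :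
    posFun g ψ =ᵐ[volume] fun x => g x * ψ x := by
  rw [posFun, dif_pos hg, ContinuousLinearMap.holderL_apply_apply]
  filter_upwards [ContinuousLinearMap.coeFn_holder (r := 2) (ContinuousLinearMap.mul ℂ ℂ)
    (hg.toLp g) ψ, hg.coeFn_toLp] with x hx hgx
  rw [hx, hgx, ContinuousLinearMap.mul_apply']

/-- The distribution `|ψ(x)|² dx` of the position in the state `ψ`. Its total mass is `‖ψ‖²`. -/
def positionLaw (ψ : L2 V) : Measure V := volume.withDensity fun x => ‖ψ x‖ₑ ^ 2

/-- The distribution of the momentum `P = -i∇` in the state `ψ`. The momentum of a plane wave of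
frequency `ξ` is `2πξ`. Its total mass is `‖ψ‖²`. -/
def momentumLaw (ψ : L2 V) : Measure V := (positionLaw (fourierOp ψ)).map ((2 * Real.pi) • ·)

theorem aemeasurable_enorm_sq (ψ : L2 V) : AEMeasurable (fun x => ‖ψ x‖ₑ ^ 2) volume :=
  (Lp.aestronglyMeasurable ψ).enorm.pow_const 2

theorem norm_fourierOp (ψ : L2 V) : ‖fourierOp ψ‖ = ‖ψ‖ :=
  (Lp.fourierTransformₗᵢ V ℂ).norm_map ψ

theorem fourierOp_fourierInvOp (ψ : L2 V) : fourierOp (fourierInvOp ψ) = ψ :=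
  (Lp.fourierTransformₗᵢ V ℂ).apply_symm_apply ψ

theorem fourierInvOp_fourierOp (ψ : L2 V) : fourierInvOp (fourierOp ψ) = ψ :=
  (Lp.fourierTransformₗᵢ V ℂ).symm_apply_apply ψ

theorem inner_fourierInvOp_right (ψ χ : L2 V) :
    ⟪ψ, fourierInvOp χ⟫_ℂ = ⟪fourierOp ψ, χ⟫_ℂ := by
  conv_rhs => rw [← fourierOp_fourierInvOp χ]
  exact ((Lp.fourierTransformₗᵢ V ℂ).inner_map_map ψ _).symm

theorem positionLaw_univ (ψ : L2 V) : positionLaw ψ univ = ‖ψ‖ₑ ^ 2 := by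
  rw [positionLaw, withDensity_apply _ .univ, Measure.restrict_univ, Lp.enorm_def,
    eLpNorm_eq_lintegral_rpow_enorm_toReal two_ne_zero ENNReal.ofNat_ne_top,
    ← ENNReal.rpow_natCast, ← ENNReal.rpow_mul]
  simp

theorem momentumLaw_univ (ψ : L2 V) : momentumLaw ψ univ = ‖ψ‖ₑ ^ 2 := by
  rw [momentumLaw, Measure.map_apply (by fun_prop) .univ, preimage_univ, positionLaw_univ,
    ← ofReal_norm, norm_fourierOp, ofReal_norm]

instance isFiniteMeasure_positionLaw (ψ : L2 V) : IsFiniteMeasure (positionLaw ψ) :=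
  ⟨by rw [positionLaw_univ]; exact ENNReal.pow_lt_top enorm_lt_top⟩

instance isFiniteMeasure_momentumLaw (ψ : L2 V) : IsFiniteMeasure (momentumLaw ψ) :=
  inferInstanceAs (IsFiniteMeasure (Measure.map _ _))

theorem positionLaw_absolutelyContinuous (ψ : L2 V) : positionLaw ψ ≪ volume :=
  withDensity_absolutelyContinuous _ _

theorem momentumLaw_absolutelyContinuous (ψ : L2 V) : momentumLaw ψ ≪ volume :=
  ((positionLaw_absolutelyContinuous _).map (by fun_prop)).trans
    (Measure.quasiMeasurePreserving_smul volume Real.two_pi_pos.ne').absolutelyContinuous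

theorem integral_positionLaw {E : Type*} [NormedAddCommGroup E] [NormedSpace ℝ E] (g : V → E)
    (ψ : L2 V) : ∫ x, g x ∂positionLaw ψ = ∫ x, ‖ψ x‖ ^ 2 • g x := by
  rw [positionLaw, integral_withDensity_eq_integral_toReal_smul₀ (aemeasurable_enorm_sq ψ)
    (ae_of_all _ fun x => ENNReal.pow_lt_top enorm_lt_top)]
  simp

theorem lintegral_positionLaw (ψ : L2 V) {w : V → ℝ≥0∞} (hw : AEMeasurable w volume) :
    ∫⁻ x, w x ∂positionLaw ψ = ∫⁻ x, w x * ‖ψ x‖ₑ ^ 2 := by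
  rw [positionLaw, lintegral_withDensity_eq_lintegral_mul₀ (aemeasurable_enorm_sq ψ) hw]
  simp only [Pi.mul_apply, mul_comm]

theorem inner_posFun (hg : MemLp g ∞ (volume : Measure V)) (ψ : L2 V) :
    ⟪ψ, posFun g ψ⟫_ℂ = ∫ x, g x ∂positionLaw ψ := by
  rw [L2.inner_def, integral_positionLaw]
  refine integral_congr_ae ?_
  filter_upwards [coeFn_posFun hg ψ] with x hx
  rw [hx, RCLike.inner_apply', mul_left_comm, RCLike.conj_mul, mul_comm, Complex.real_smul,
    Complex.ofReal_pow]
  rfl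

theorem inner_momFun (hg : MemLp g ∞ (volume : Measure V)) (ψ : L2 V) :
    ⟪ψ, momFun g ψ⟫_ℂ = ∫ p, g p ∂momentumLaw ψ := by
  have hmap : MemLp g ∞ ((volume : Measure V).map ((2 * Real.pi) • ·)) := by
    rw [Measure.map_addHaar_smul _ Real.two_pi_pos.ne']
    exact hg.smul_measure ENNReal.ofReal_ne_top
  have hscale : MemLp (fun ξ => g ((2 * Real.pi) • ξ)) ∞ (volume : Measure V) :=
    (memLp_map_measure_iff hmap.1 (by fun_prop)).1 hmap
  rw [momFun, ContinuousLinearMap.comp_apply, inner_fourierInvOp_right,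
    ContinuousLinearMap.comp_apply, inner_posFun hscale, momentumLaw,
    integral_map (by fun_prop) (hg.1.mono_ac (momentumLaw_absolutelyContinuous ψ))]

theorem memLp_chi (hA : MeasurableSet A) : MemLp (chi A) ∞ (volume : Measure V) :=
  memLp_top_of_bound ((measurable_one.indicator hA).aestronglyMeasurable) 1
    (ae_of_all _ (norm_chi_le_one A))

theorem inner_posFun_chi (hA : MeasurableSet A) (ψ : L2 V) :
    ⟪ψ, posFun (chi A) ψ⟫_ℂ = ((positionLaw ψ).real A : ℂ) := by
  rw [inner_posFun (memLp_chi hA), chi, integral_indicator hA]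
  simp

theorem inner_momFun_chi (hA : MeasurableSet A) (ψ : L2 V) :
    ⟪ψ, momFun (chi A) ψ⟫_ℂ = ((momentumLaw ψ).real A : ℂ) := by
  rw [inner_momFun (memLp_chi hA), chi, integral_indicator hA]
  simp

theorem posFun_chi_univ : posFun (chi (univ : Set V)) = ContinuousLinearMap.id ℂ (L2 V) := by
  ext1 ψ
  refine Lp.ext ?_
  filter_upwards [coeFn_posFun (memLp_chi MeasurableSet.univ) ψ] with x hx
  rw [hx, chi, indicator_univ, Pi.one_apply, one_mul]
  rfl

theorem momFun_chi_univ : momFun (chi (univ : Set V)) = ContinuousLinearMap.id ℂ (L2 V) := by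
  ext1 ψ
  have h : (fun ξ : V => chi (univ : Set V) ((2 * Real.pi) • ξ)) = chi univ := by
    ext; simp [chi]
  rw [momFun, h, posFun_chi_univ]
  exact fourierInvOp_fourierOp ψ

end Laws

section Translation

variable {V : Type} [NormedAddCommGroup V] [InnerProductSpace ℝ V] [FiniteDimensional ℝ V]
  [MeasurableSpace V] [BorelSpace V]

/-- The translation `(translate v φ)(x) = φ(x + v)` of wave functions. In terms of the momentum it
is the unitary operator `exp(i⟨v, P⟩)`. -/
def translate (v : V) : L2 V →ₗᵢ[ℂ] L2 V :=
  Lp.compMeasurePreservingₗᵢ ℂ (· + v) (measurePreserving_add_right volume v)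

theorem coeFn_translate (v : V) (φ : L2 V) : translate v φ =ᵐ[volume] fun x => φ (x + v) :=
  Lp.coeFn_compMeasurePreserving φ (measurePreserving_add_right volume v)

theorem translate_toLp (v : V) (f : SchwartzMap V ℂ) :
    translate v (f.toLp 2) = (SchwartzMap.compSubConstCLM ℂ (-v) f).toLp 2 := by
  have hf : ∀ᵐ x, f.toLp 2 volume x = f x := f.coeFn_toLp 2 volume
  refine Lp.ext ?_
  filter_upwards [coeFn_translate v (f.toLp 2), (SchwartzMap.compSubConstCLM ℂ (-v) f).coeFn_toLp 2,
    (measurePreserving_add_right volume v).quasiMeasurePreserving.tendsto_ae.eventually hf]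
    with x hx hx' hfx
  rw [hx, hx', hfx, SchwartzMap.compSubConstCLM_apply, sub_neg_eq_add]

theorem memLp_exp_inner (v : V) :
    MemLp (fun p : V => Complex.exp (⟪p, v⟫_ℝ * Complex.I)) ∞ (volume : Measure V) :=
  memLp_top_of_bound (by fun_prop) 1 (ae_of_all _ fun p => (Complex.norm_exp_ofReal_mul_I _).le)

theorem memLp_fourierChar_inner (v : V) :
    MemLp (fun ξ : V => (Real.fourierChar ⟪v, ξ⟫_ℝ : ℂ)) ∞ (volume : Measure V) :=
  memLp_top_of_bound (by fun_prop) 1 (ae_of_all _ fun ξ => (Circle.norm_coe _).le)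

theorem fourierOp_toLp (f : SchwartzMap V ℂ) : ∀ᵐ ξ, fourierOp (f.toLp 2) ξ = 𝓕 (f : V → ℂ) ξ := by
  have h : fourierOp (f.toLp 2) = (𝓕 f).toLp 2 := SchwartzMap.toLp_fourier_eq f
  rw [h]
  exact (𝓕 f).coeFn_toLp 2 volume

theorem fourierOp_translate (v : V) (φ : L2 V) :
    fourierOp (translate v φ) =
      posFun (fun ξ => (Real.fourierChar ⟪v, ξ⟫_ℝ : ℂ)) (fourierOp φ) := by
  have hdense := SchwartzMap.denseRange_toLpCLM (E := V) (F := ℂ) (p := 2) (μ := volume)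
    ENNReal.ofNat_ne_top
  refine hdense.induction_on φ (isClosed_eq ?_ ?_) fun f => ?_
  · exact fourierOp.continuous.comp (translate v).continuous
  · exact (posFun _).continuous.comp fourierOp.continuous
  · rw [SchwartzMap.toLpCLM_apply, translate_toLp]
    refine Lp.ext ?_
    filter_upwards [fourierOp_toLp (SchwartzMap.compSubConstCLM ℂ (-v) f), fourierOp_toLp f,
      coeFn_posFun (memLp_fourierChar_inner v) (fourierOp (f.toLp 2))] with ξ hξ hfξ hpos
    have hcomp : ⇑(SchwartzMap.compSubConstCLM ℂ (-v) f) = f ∘ (· + v) := by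
      ext x; simp
    rw [hξ, hpos, hfξ, hcomp]
    exact congrFun (VectorFourier.fourierIntegral_comp_add_right Real.fourierChar volume
      (innerₗ V) f v) ξ

theorem translate_eq_momFun (v : V) :
    (translate v).toContinuousLinearMap = momFun fun p => Complex.exp (⟪p, v⟫_ℝ * Complex.I) := by
  ext1 φ
  have h : (fun ξ : V => Complex.exp (⟪(2 * Real.pi) • ξ, v⟫_ℝ * Complex.I)) =
      fun ξ => (Real.fourierChar ⟪v, ξ⟫_ℝ : ℂ) := by
    ext ξ
    rw [Real.fourierChar_apply, real_inner_smul_left, real_inner_comm]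
  rw [momFun, h, ContinuousLinearMap.comp_apply, ContinuousLinearMap.comp_apply,
    ← fourierOp_translate, fourierInvOp_fourierOp]
  rfl

theorem charFun_momentumLaw (φ : L2 V) (v : V) :
    charFun (momentumLaw φ) v = ⟪φ, translate v φ⟫_ℂ := by
  rw [charFun_apply, ← inner_momFun (memLp_exp_inner v), ← translate_eq_momFun]
  rfl

end Translation

section Coupling

theorem inner_tensor (ψ ψ' : L2 ℝ) (φ φ' : L2 ProbeConf) :
    ⟪tensor ψ φ, tensor ψ' φ'⟫_ℂ = ⟪ψ, ψ'⟫_ℂ * ⟪φ, φ'⟫_ℂ := by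
  have hmeas : AEStronglyMeasurable (fun z : ℝ × ProbeConf => ⟪ψ z.1, ψ' z.1⟫_ℂ * ⟪φ z.2, φ' z.2⟫_ℂ)
      (volume.map splitConf) := by
    rw [measurePreserving_splitConf.map_eq]
    exact ((Lp.aestronglyMeasurable ψ).inner (Lp.aestronglyMeasurable ψ')).comp_fst.mul
      ((Lp.aestronglyMeasurable φ).inner (Lp.aestronglyMeasurable φ')).comp_snd
  simp only [L2.inner_def]
  rw [← integral_prod_mul, ← Measure.volume_eq_prod, ← measurePreserving_splitConf.map_eq,
    integral_map measurePreserving_splitConf.measurable.aemeasurable hmeas]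
  refine integral_congr_ae ?_
  filter_upwards [(memLp_tensor ψ φ).coeFn_toLp, (memLp_tensor ψ' φ').coeFn_toLp] with x hx hx'
  rw [tensor, tensor, hx, hx']
  simp only [RCLike.inner_apply', map_mul]
  ring

theorem splitConf_add (x y : TotalConf) : splitConf (x + y) = splitConf x + splitConf y := by
  refine Prod.ext rfl ?_
  ext i
  fin_cases i <;> rfl

theorem couplingFlow_map_add (lam mu kap t : ℝ) (x y : TotalConf) :
    couplingFlow lam mu kap t (x + y) =
      couplingFlow lam mu kap t x + couplingFlow lam mu kap t y := by
  rw [couplingFlow_eq_toLpLin, map_add]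

theorem tendsto_fst_splitConf :
    Filter.Tendsto (fun x : TotalConf => (splitConf x).1) (ae volume) (ae volume) :=
  Measure.quasiMeasurePreserving_fst.tendsto_ae.comp
    measurePreserving_splitConf.quasiMeasurePreserving.tendsto_ae

theorem coeFn_coupling (lam mu kap : ℝ) (Φ : L2 TotalConf) :
    coupling lam mu kap Φ =ᵐ[volume] fun x => Φ (couplingFlow lam mu kap 1 x) :=
  Lp.coeFn_compMeasurePreserving Φ (measurePreserving_couplingFlow lam mu kap 1)

theorem translate_tensor (v : TotalConf) (ψ : L2 ℝ) (φ : L2 ProbeConf) :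
    translate v (tensor ψ φ) =
      tensor (translate (splitConf v).1 ψ) (translate (splitConf v).2 φ) := by
  refine Lp.ext ?_
  filter_upwards [coeFn_translate v (tensor ψ φ),
    (measurePreserving_add_right volume v).quasiMeasurePreserving.tendsto_ae.eventually
      (memLp_tensor ψ φ).coeFn_toLp,
    (memLp_tensor (translate (splitConf v).1 ψ) (translate (splitConf v).2 φ)).coeFn_toLp,
    tendsto_fst_splitConf.eventually (coeFn_translate (splitConf v).1 ψ),
    tendsto_snd_splitConf.eventually (coeFn_translate (splitConf v).2 φ)]
    with x hx hxv htensor hψ hφ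
  rw [hx, tensor, hxv, tensor, htensor, hψ, hφ, splitConf_add]
  rfl

theorem translate_coupling (lam mu kap : ℝ) (v : TotalConf) (Φ : L2 TotalConf) :
    translate v (coupling lam mu kap Φ) =
      coupling lam mu kap (translate (couplingFlow lam mu kap 1 v) Φ) := by
  refine Lp.ext ?_
  filter_upwards [coeFn_translate v (coupling lam mu kap Φ),
    (measurePreserving_add_right volume v).quasiMeasurePreserving.tendsto_ae.eventually
      (coeFn_coupling lam mu kap Φ),
    coeFn_coupling lam mu kap (translate (couplingFlow lam mu kap 1 v) Φ),
    (measurePreserving_couplingFlow lam mu kap 1).quasiMeasurePreserving.tendsto_ae.eventually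
      (coeFn_translate (couplingFlow lam mu kap 1 v) Φ)] with x hx hxv hcoupling hflow
  rw [hx, hxv, hcoupling, hflow, couplingFlow_map_add]

theorem charFun_momentumLaw_tensor (ψ : L2 ℝ) (φ : L2 ProbeConf) (v : TotalConf) :
    charFun (momentumLaw (tensor ψ φ)) v =
      charFun (momentumLaw ψ) (splitConf v).1 * charFun (momentumLaw φ) (splitConf v).2 := by
  simp only [charFun_momentumLaw, translate_tensor, inner_tensor]

theorem charFun_momentumLaw_coupling (lam mu kap : ℝ) (Φ : L2 TotalConf) (v : TotalConf) :
    charFun (momentumLaw (coupling lam mu kap Φ)) v =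
      charFun (momentumLaw Φ) (couplingFlow lam mu kap 1 v) := by
  rw [charFun_momentumLaw, charFun_momentumLaw, translate_coupling]
  exact (Lp.compMeasurePreservingₗᵢ ℂ _ (measurePreserving_couplingFlow lam mu kap 1)).inner_map_map
    Φ _

theorem map_couplingFlow_positionLaw_coupling (lam mu kap : ℝ) (Φ : L2 TotalConf) :
    (positionLaw (coupling lam mu kap Φ)).map (couplingFlow lam mu kap 1) = positionLaw Φ := by
  refine map_withDensity_comp (measurePreserving_couplingFlow lam mu kap 1)
    (aemeasurable_enorm_sq Φ) ?_
  filter_upwards [coeFn_coupling lam mu kap Φ] with x hx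
  rw [hx, Function.comp_apply]

theorem map_splitConf_positionLaw_tensor (ψ : L2 ℝ) (φ : L2 ProbeConf) :
    (positionLaw (tensor ψ φ)).map splitConf = (positionLaw ψ).prod (positionLaw φ) := by
  rw [positionLaw, positionLaw, positionLaw,
    prod_withDensity₀ (aemeasurable_enorm_sq ψ) (aemeasurable_enorm_sq φ),
    ← Measure.volume_eq_prod]
  refine map_withDensity_comp measurePreserving_splitConf
    ((aemeasurable_enorm_sq ψ).comp_fst.mul (aemeasurable_enorm_sq φ).comp_snd) ?_
  filter_upwards [(memLp_tensor ψ φ).coeFn_toLp] with x hx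
  rw [tensor, hx, enorm_mul, mul_pow, Function.comp_apply]

theorem charFun_map_inner {V : Type} [NormedAddCommGroup V] [InnerProductSpace ℝ V]
    [MeasurableSpace V] [BorelSpace V] [SecondCountableTopology V] (μ : Measure V) (w : V) (t : ℝ) :
    charFun (μ.map (⟪w, ·⟫_ℝ)) t = charFun μ (t • w) := by
  rw [charFun_apply, charFun_apply, integral_map (by fun_prop) (by fun_prop)]
  simp only [real_inner_smul_right, real_inner_comm w, RCLike.inner_apply, conj_trivial]

/-- The linear form on the probe positions by which the rescaled pointer reading `Q₁ / λ` after
the coupling differs from the position of the system before the coupling. -/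
def positionNoiseVec (lam mu kap : ℝ) : ProbeConf := !₂[1 / lam, mu / 2 * (kap - 1)]

/-- The linear form on the probe momenta by which the rescaled pointer reading `P₂ / μ` after the
coupling differs from the momentum of the system before the coupling. -/
def momentumNoiseVec (lam mu kap : ℝ) : ProbeConf := !₂[-(lam / 2 * (kap + 1)), 1 / mu]

theorem inner_positionNoiseVec_momentumNoiseVec {lam mu : ℝ} (hlam : lam ≠ 0) (hmu : mu ≠ 0)
    (kap : ℝ) : ⟪positionNoiseVec lam mu kap, momentumNoiseVec lam mu kap⟫_ℝ = -1 := by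
  simp only [positionNoiseVec, momentumNoiseVec, PiLp.inner_apply, RCLike.inner_apply,
    conj_trivial, Fin.sum_univ_two, Matrix.cons_val_zero, Matrix.cons_val_one]
  field_simp
  ring

theorem map_positionLaw_coupling_tensor {lam : ℝ} (hlam : lam ≠ 0) (mu kap : ℝ) (ψ : L2 ℝ)
    (φ : L2 ProbeConf) :
    (positionLaw (coupling lam mu kap (tensor ψ φ))).map (fun x => x 1 / lam) =
      positionLaw ψ ∗ (positionLaw φ).map (⟪positionNoiseVec lam mu kap, ·⟫_ℝ) := by
  have hpointer : (fun x : TotalConf => x 1 / lam) =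
      ((fun z : ℝ × ℝ => z.1 + z.2) ∘ Prod.map id (⟪positionNoiseVec lam mu kap, ·⟫_ℝ)) ∘
        splitConf ∘ couplingFlow lam mu kap 1 := by
    ext x
    simp only [splitConf, couplingFlow, positionNoiseVec, PiLp.inner_apply, RCLike.inner_apply,
      Real.ringHom_apply, Fin.sum_univ_two, Matrix.cons_val_zero, Matrix.cons_val_one,
      Matrix.cons_val_fin_one, Matrix.cons_val, Function.comp_apply, Prod.map_apply, id_eq]
    field_simp
    ring
  have hsplit := measurePreserving_splitConf.measurable
  have hflow := (measurePreserving_couplingFlow lam mu kap 1).measurable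
  rw [hpointer, ← Measure.map_map (by fun_prop) (hsplit.comp hflow), ← Measure.map_map hsplit hflow,
    map_couplingFlow_positionLaw_coupling, map_splitConf_positionLaw_tensor,
    ← Measure.map_map (by fun_prop) (by fun_prop), ← Measure.map_prod_map _ _ (by fun_prop)
      (by fun_prop), Measure.map_id]
  rfl

theorem map_momentumLaw_coupling_tensor (lam : ℝ) {mu : ℝ} (hmu : mu ≠ 0) (kap : ℝ) (ψ : L2 ℝ)
    (φ : L2 ProbeConf) :
    (momentumLaw (coupling lam mu kap (tensor ψ φ))).map (fun p => p 2 / mu) =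
      momentumLaw ψ ∗ (momentumLaw φ).map (⟪momentumNoiseVec lam mu kap, ·⟫_ℝ) := by
  have hpointer : (fun p : TotalConf => p 2 / mu) = (⟪EuclideanSpace.single 2 (1 / mu), ·⟫_ℝ) := by
    ext p
    rw [EuclideanSpace.inner_single_left]
    simp [div_eq_mul_inv, mul_comm]
  have hsplit (t : ℝ) :
      splitConf (couplingFlow lam mu kap 1 (t • EuclideanSpace.single 2 (1 / mu))) =
        (t, t • momentumNoiseVec lam mu kap) := by
    refine Prod.ext ?_ ?_
    · simp [splitConf, couplingFlow, mul_left_comm mu, hmu]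
    · ext i
      fin_cases i
      · simp only [splitConf, couplingFlow, Fin.isValue, one_div, PiLp.smul_apply, ne_eq,
          Fin.reduceEq, not_false_eq_true, PiLp.single_eq_of_ne, smul_eq_mul, mul_zero, one_mul,
          PiLp.single_eq_same, zero_add, sub_self, one_pow, zero_sub, Matrix.cons_val_zero,
          Matrix.cons_val_one, Matrix.cons_val, Fin.zero_eta, momentumNoiseVec, mul_neg, neg_inj]
        field
      · simp [splitConf, couplingFlow, momentumNoiseVec]
  refine Measure.ext_of_charFun (funext fun t => ?_)
  rw [hpointer, charFun_map_inner, charFun_momentumLaw_coupling, charFun_momentumLaw_tensor,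
    charFun_conv, charFun_map_inner, hsplit]

end Coupling

section Uncertainty

open scoped Topology

variable {V : Type} [NormedAddCommGroup V] [InnerProductSpace ℝ V] [FiniteDimensional ℝ V]
  [MeasurableSpace V] [BorelSpace V]

theorem eLpNorm_positionLaw {w : V → ℝ} (hw : AEStronglyMeasurable w volume) (φ : L2 V) :
    eLpNorm w 2 (positionLaw φ) = eLpNorm (fun x => w x • φ x) 2 volume := by
  simp only [eLpNorm_eq_lintegral_rpow_enorm_toReal two_ne_zero ENNReal.ofNat_ne_top,
    ENNReal.toReal_ofNat, ENNReal.rpow_ofNat]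
  rw [lintegral_positionLaw φ (hw.enorm.pow_const 2)]
  simp only [enorm_smul, mul_pow]

theorem memLp_smul_of_memLp_positionLaw {w : V → ℝ} (hw : AEStronglyMeasurable w volume) {φ : L2 V}
    (h : MemLp w 2 (positionLaw φ)) : MemLp (fun x => w x • φ x) 2 volume :=
  ⟨hw.smul (Lp.aestronglyMeasurable φ), by rw [← eLpNorm_positionLaw hw]; exact h.2⟩

theorem integrable_norm_sq_smul {w : V → ℝ} (hw : AEStronglyMeasurable w volume) {φ : L2 V}
    (h : MemLp w 2 (positionLaw φ)) : Integrable (fun x => ‖φ x‖ ^ 2 • w x) volume := by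
  refine ((Lp.memLp φ).norm.integrable_mul (memLp_smul_of_memLp_positionLaw hw h).norm).mono'
    (((Lp.aestronglyMeasurable φ).norm.pow 2).smul hw) (ae_of_all _ fun x => le_of_eq ?_)
  simp only [norm_smul, norm_pow, norm_norm, Pi.mul_apply]
  ring

theorem norm_norm_sq_smul_sub_le {E : Type*} [NormedAddCommGroup E] [NormedSpace ℝ E] (a b : E)
    (r : ℝ) : ‖‖a‖ ^ 2 • r - ‖b‖ ^ 2 • r‖ ≤ ‖a - b‖ * (‖r • a‖ + ‖r • b‖) :=
  calc ‖‖a‖ ^ 2 • r - ‖b‖ ^ 2 • r‖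
      = |‖a‖ - ‖b‖| * ((‖a‖ + ‖b‖) * |r|) := by
        rw [← sub_smul, sq_sub_sq, norm_smul, norm_mul, Real.norm_eq_abs, Real.norm_eq_abs,
          Real.norm_eq_abs, abs_of_nonneg (by positivity : 0 ≤ ‖a‖ + ‖b‖)]
        ring
    _ ≤ ‖a - b‖ * ((‖a‖ + ‖b‖) * |r|) := by
        gcongr
        exact abs_norm_sub_norm_le _ _
    _ = ‖a - b‖ * (‖r • a‖ + ‖r • b‖) := by
        simp only [norm_smul, Real.norm_eq_abs]
        ring

theorem enorm_integral_positionLaw_sub_le {w : V → ℝ} (hw : AEStronglyMeasurable w volume)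
    {φ χ : L2 V} (hφ : MemLp w 2 (positionLaw φ)) (hχ : MemLp w 2 (positionLaw χ)) :
    ‖∫ x, w x ∂positionLaw φ - ∫ x, w x ∂positionLaw χ‖ₑ ≤
      ‖φ - χ‖ₑ * (eLpNorm w 2 (positionLaw φ) + eLpNorm w 2 (positionLaw χ)) := by
  have hwφ := (memLp_smul_of_memLp_positionLaw hw hφ).norm
  have hwχ := (memLp_smul_of_memLp_positionLaw hw hχ).norm
  calc ‖∫ x, w x ∂positionLaw φ - ∫ x, w x ∂positionLaw χ‖ₑ
      = ‖∫ x, ‖φ x‖ ^ 2 • w x - ‖χ x‖ ^ 2 • w x‖ₑ := by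
        rw [integral_positionLaw, integral_positionLaw, integral_sub
          (integrable_norm_sq_smul hw hφ) (integrable_norm_sq_smul hw hχ)]
    _ ≤ eLpNorm (fun x => ‖φ x‖ ^ 2 • w x - ‖χ x‖ ^ 2 • w x) 1 volume := by
        rw [eLpNorm_one_eq_lintegral_enorm]
        exact enorm_integral_le_lintegral_enorm _
    _ ≤ eLpNorm ((fun x => ‖(φ - χ : V → ℂ) x‖) • fun x => ‖w x • φ x‖ + ‖w x • χ x‖) 1 volume :=
        eLpNorm_mono fun x =>
          (norm_norm_sq_smul_sub_le (φ x) (χ x) (w x)).trans (le_abs_self _)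
    _ ≤ eLpNorm (fun x => ‖(φ - χ : V → ℂ) x‖) 2 volume *
          eLpNorm (fun x => ‖w x • φ x‖ + ‖w x • χ x‖) 2 volume :=
        eLpNorm_smul_le_mul_eLpNorm (hwφ.1.add hwχ.1)
          ((Lp.aestronglyMeasurable φ).sub (Lp.aestronglyMeasurable χ)).norm
    _ ≤ ‖φ - χ‖ₑ * (eLpNorm w 2 (positionLaw φ) + eLpNorm w 2 (positionLaw χ)) := by
        rw [eLpNorm_norm, ← eLpNorm_congr_ae (Lp.coeFn_sub φ χ), ← Lp.enorm_def,
          eLpNorm_positionLaw hw, eLpNorm_positionLaw hw]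
        gcongr
        refine (eLpNorm_add_le hwφ.1 hwχ.1 one_le_two).trans_eq ?_
        rw [eLpNorm_norm, eLpNorm_norm]

theorem enorm_fourierOp (φ : L2 V) : ‖fourierOp φ‖ₑ = ‖φ‖ₑ := by
  rw [← ofReal_norm, norm_fourierOp, ofReal_norm]

theorem enorm_translate_sub_smul_le (v : V) (θ : ℝ) (φ : L2 V) :
    ‖translate v φ - Complex.exp (Complex.I * θ) • φ‖ₑ ≤
      eLpNorm (fun p => ⟪v, p⟫_ℝ - θ) 2 (momentumLaw φ) := by
  rw [← enorm_fourierOp, map_sub, map_smul, fourierOp_translate, momentumLaw,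
    eLpNorm_map_measure (by fun_prop) (by fun_prop), eLpNorm_positionLaw (by fun_prop),
    Lp.enorm_def]
  refine eLpNorm_mono_enorm_ae ?_
  filter_upwards [Lp.coeFn_sub (posFun (fun ξ => (Real.fourierChar ⟪v, ξ⟫_ℝ : ℂ)) (fourierOp φ))
    (Complex.exp (Complex.I * θ) • fourierOp φ), coeFn_posFun (memLp_fourierChar_inner v)
    (fourierOp φ), Lp.coeFn_smul (Complex.exp (Complex.I * θ)) (fourierOp φ)] with ξ hsub hpos hsmul
  have hphase : (Real.fourierChar ⟪v, ξ⟫_ℝ : ℂ) - Complex.exp (Complex.I * θ) =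
      Complex.exp (Complex.I * θ) *
        (Complex.exp (Complex.I * ((⟪v, (2 * Real.pi) • ξ⟫_ℝ - θ : ℝ) : ℂ)) - 1) := by
    rw [mul_sub, ← Complex.exp_add, mul_one, Real.fourierChar_apply, real_inner_smul_right]
    push_cast
    ring_nf
  rw [hsub, Pi.sub_apply, hpos, hsmul, Pi.smul_apply, smul_eq_mul, ← sub_mul, hphase, enorm_mul,
    enorm_mul, enorm_smul]
  gcongr
  rw [mul_comm Complex.I, ← ofReal_norm, Complex.norm_exp_ofReal_mul_I, ENNReal.ofReal_one, one_mul]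
  exact Real.enorm_exp_I_mul_ofReal_sub_one_le

theorem positionLaw_translate (v : V) (φ : L2 V) :
    positionLaw (translate v φ) = (positionLaw φ).map (· - v) := by
  refine (map_withDensity_comp (measurePreserving_sub_right volume v)
    (aemeasurable_enorm_sq (translate v φ)) ?_).symm
  have hsub := (measurePreserving_sub_right volume v).quasiMeasurePreserving.tendsto_ae
  filter_upwards [hsub.eventually (coeFn_translate v φ)] with x hx
  rw [Function.comp_apply, hx, sub_add_cancel]

theorem positionLaw_smul_of_norm_eq_one {c : ℂ} (hc : ‖c‖ = 1) (φ : L2 V) :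
    positionLaw (c • φ) = positionLaw φ := by
  refine withDensity_congr_ae ?_
  filter_upwards [Lp.coeFn_smul c φ] with x hx
  rw [hx, Pi.smul_apply, enorm_smul, ← ofReal_norm c, hc, ENNReal.ofReal_one, one_mul]

theorem eLpNorm_positionLaw_translate_le (u v : V) (a : ℝ) (φ : L2 V) :
    eLpNorm (fun x => ⟪u, x⟫_ℝ - a) 2 (positionLaw (translate v φ)) ≤
      eLpNorm (fun x => ⟪u, x⟫_ℝ - a) 2 (positionLaw φ) + ‖⟪u, v⟫_ℝ‖ₑ * ‖φ‖ₑ := by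
  have hshift : (fun x : V => ⟪u, x⟫_ℝ - a) ∘ (· - v) =
      (fun x => ⟪u, x⟫_ℝ - a) - fun _ => ⟪u, v⟫_ℝ := by
    ext x
    simp only [Function.comp_apply, inner_sub_right, Pi.sub_apply]
    ring
  rw [positionLaw_translate, eLpNorm_map_measure (by fun_prop) (by fun_prop), hshift]
  refine (eLpNorm_sub_le (by fun_prop) (by fun_prop) one_le_two).trans_eq ?_
  rw [eLpNorm_const' _ two_ne_zero ENNReal.ofNat_ne_top, positionLaw_univ, ← ENNReal.rpow_natCast,
    ← ENNReal.rpow_mul]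
  simp

theorem integral_positionLaw_translate (u v : V) {a : ℝ} {φ : L2 V}
    (h : MemLp (fun x => ⟪u, x⟫_ℝ - a) 2 (positionLaw φ)) :
    ∫ x, ⟪u, x⟫_ℝ - a ∂positionLaw (translate v φ) =
      ∫ x, ⟪u, x⟫_ℝ - a ∂positionLaw φ - ⟪u, v⟫_ℝ * ‖φ‖ ^ 2 := by
  have hmass : (positionLaw φ).real univ = ‖φ‖ ^ 2 := by
    rw [measureReal_def, positionLaw_univ, ENNReal.toReal_pow, toReal_enorm]
  have hshift (x : V) : ⟪u, x - v⟫_ℝ - a = ⟪u, x⟫_ℝ - a - ⟪u, v⟫_ℝ := by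
    rw [inner_sub_right]
    ring
  rw [positionLaw_translate, integral_map (by fun_prop) (by fun_prop)]
  simp only [hshift]
  rw [integral_sub (h.integrable one_le_two) (integrable_const _), integral_const, hmass,
    smul_eq_mul, mul_comm]

theorem memLp_inner_sub_translate {u : V} (v : V) {a : ℝ} {φ : L2 V}
    (h : MemLp (fun x => ⟪u, x⟫_ℝ - a) 2 (positionLaw φ)) :
    MemLp (fun x => ⟪u, x⟫_ℝ - a) 2 (positionLaw (translate v φ)) :=
  ⟨by fun_prop, (eLpNorm_positionLaw_translate_le u v a φ).trans_lt
    (ENNReal.add_lt_top.2 ⟨h.2, ENNReal.mul_lt_top enorm_lt_top enorm_lt_top⟩)⟩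

theorem enorm_inner_mul_enorm_sq_le (u v : V) {a : ℝ} (b : ℝ) {φ : L2 V}
    (h : MemLp (fun x => ⟪u, x⟫_ℝ - a) 2 (positionLaw φ)) :
    ‖⟪u, v⟫_ℝ‖ₑ * ‖φ‖ₑ ^ 2 ≤ eLpNorm (fun p => ⟪v, p⟫_ℝ - b) 2 (momentumLaw φ) *
      (2 * eLpNorm (fun x => ⟪u, x⟫_ℝ - a) 2 (positionLaw φ) + ‖⟪u, v⟫_ℝ‖ₑ * ‖φ‖ₑ) := by
  set c : ℂ := Complex.exp (Complex.I * b) with hc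
  have hcφ : positionLaw (c • φ) = positionLaw φ := positionLaw_smul_of_norm_eq_one
    (by rw [hc, mul_comm, Complex.norm_exp_ofReal_mul_I]) φ
  have hmean := integral_positionLaw_translate u v h
  calc ‖⟪u, v⟫_ℝ‖ₑ * ‖φ‖ₑ ^ 2
      = ‖∫ x, ⟪u, x⟫_ℝ - a ∂positionLaw (translate v φ) -
          ∫ x, ⟪u, x⟫_ℝ - a ∂positionLaw (c • φ)‖ₑ := by
        rw [hmean, hcφ, sub_sub_cancel_left, enorm_neg, enorm_mul, enorm_pow, enorm_norm]
    _ ≤ ‖translate v φ - c • φ‖ₑ * (eLpNorm (fun x => ⟪u, x⟫_ℝ - a) 2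
          (positionLaw (translate v φ)) +
            eLpNorm (fun x => ⟪u, x⟫_ℝ - a) 2 (positionLaw (c • φ))) :=
        enorm_integral_positionLaw_sub_le (by fun_prop) (memLp_inner_sub_translate v h)
          (by rwa [hcφ])
    _ ≤ eLpNorm (fun p => ⟪v, p⟫_ℝ - b) 2 (momentumLaw φ) *
          (eLpNorm (fun x => ⟪u, x⟫_ℝ - a) 2 (positionLaw φ) + ‖⟪u, v⟫_ℝ‖ₑ * ‖φ‖ₑ +
            eLpNorm (fun x => ⟪u, x⟫_ℝ - a) 2 (positionLaw φ)) := by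
        rw [hcφ]
        gcongr
        · exact enorm_translate_sub_smul_le v b φ
        · exact eLpNorm_positionLaw_translate_le u v a φ
    _ = _ := by ring

theorem enorm_inner_mul_enorm_sq_le_of_memLp (u v : V) {a b : ℝ} {φ : L2 V}
    (hpos : MemLp (fun x => ⟪u, x⟫_ℝ - a) 2 (positionLaw φ))
    (hmom : MemLp (fun p => ⟪v, p⟫_ℝ - b) 2 (momentumLaw φ)) :
    ‖⟪u, v⟫_ℝ‖ₑ * ‖φ‖ₑ ^ 2 ≤ 2 * (eLpNorm (fun x => ⟪u, x⟫_ℝ - a) 2 (positionLaw φ) *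
      eLpNorm (fun p => ⟪v, p⟫_ℝ - b) 2 (momentumLaw φ)) := by
  set I := eLpNorm (fun x => ⟪u, x⟫_ℝ - a) 2 (positionLaw φ)
  set J := eLpNorm (fun p => ⟪v, p⟫_ℝ - b) 2 (momentumLaw φ) with hJ
  -- The previous estimate for the translation by `t • v`, divided by `t`.
  have hsmall : ∀ᶠ t : ℝ in 𝓝[≠] 0,
      ‖⟪u, v⟫_ℝ‖ₑ * ‖φ‖ₑ ^ 2 ≤ J * (2 * I + ‖t‖ₑ * (‖⟪u, v⟫_ℝ‖ₑ * ‖φ‖ₑ)) := by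
    filter_upwards [self_mem_nhdsWithin] with t ht
    have hscale : (fun p : V => ⟪t • v, p⟫_ℝ - t * b) = t • fun p => ⟪v, p⟫_ℝ - b := by
      ext p
      simp only [real_inner_smul_left, Pi.smul_apply, smul_eq_mul, mul_sub]
    have htranslate := enorm_inner_mul_enorm_sq_le u (t • v) (t * b) hpos
    rw [hscale, eLpNorm_const_smul, ← hJ, real_inner_smul_right, enorm_mul, mul_assoc, mul_assoc,
      mul_assoc] at htranslate
    exact (ENNReal.mul_le_mul_iff_right (enorm_ne_zero.2 ht) enorm_ne_top).1 htranslate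
  have hcont : Continuous fun t : ℝ => J * (2 * I + ‖t‖ₑ * (‖⟪u, v⟫_ℝ‖ₑ * ‖φ‖ₑ)) :=
    (ENNReal.continuous_const_mul hmom.2.ne).comp (continuous_const.add
      ((ENNReal.continuous_mul_const (by finiteness)).comp continuous_enorm))
  have hlim := ge_of_tendsto ((hcont.tendsto 0).mono_left nhdsWithin_le_nhds) hsmall
  refine hlim.trans_eq ?_
  rw [enorm_zero, zero_mul, add_zero]
  ring

theorem eLpNorm_inner_sub_ne_zero {ν : Measure V} (hν : ν ≪ volume) (hν0 : ν ≠ 0) {u : V}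
    (hu : u ≠ 0) (a : ℝ) : eLpNorm (fun x => ⟪u, x⟫_ℝ - a) 2 ν ≠ 0 := by
  intro h
  have hsurj : Function.Surjective (innerₗ V u) :=
    (innerₗ V u).surjective_iff_ne_zero.2 fun h0 =>
      hu (inner_self_eq_zero.1 (LinearMap.congr_fun h0 u))
  have hhyperplane : ∀ᵐ x ∂ν, ⟪u, x⟫_ℝ ∈ ({a}ᶜ : Set ℝ) :=
    hν.ae_le ((ae_comp_linearMap_mem_iff (innerₗ V u) volume volume hsurj
      (measurableSet_singleton a).compl).2 (Measure.ae_ne volume a))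
  rw [eLpNorm_eq_zero_iff (by fun_prop) two_ne_zero] at h
  refine hν0 (ae_eq_bot.1 (Filter.eventually_false_iff_eq_bot.1 ?_))
  filter_upwards [h, hhyperplane] with x hx hxa
  exact hxa (sub_eq_zero.1 hx)

theorem enorm_inner_mul_enorm_sq_le_two_mul_eLpNorm_mul_eLpNorm (u v : V) (a b : ℝ) (φ : L2 V) :
    ‖⟪u, v⟫_ℝ‖ₑ * ‖φ‖ₑ ^ 2 ≤ 2 * (eLpNorm (fun x => ⟪u, x⟫_ℝ - a) 2 (positionLaw φ) *
      eLpNorm (fun p => ⟪v, p⟫_ℝ - b) 2 (momentumLaw φ)) := by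
  rcases eq_or_ne φ 0 with rfl | hφ
  · simp
  rcases eq_or_ne u 0 with rfl | hu
  · simp
  rcases eq_or_ne v 0 with rfl | hv
  · simp
  have hmass : ‖φ‖ₑ ^ 2 ≠ 0 := pow_ne_zero 2 (enorm_ne_zero.2 hφ)
  have hpos0 := eLpNorm_inner_sub_ne_zero (positionLaw_absolutelyContinuous φ)
    (fun h => hmass (by rw [← positionLaw_univ, h]; rfl)) hu a
  have hmom0 := eLpNorm_inner_sub_ne_zero (momentumLaw_absolutelyContinuous φ)
    (fun h => hmass (by rw [← momentumLaw_univ, h]; rfl)) hv b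
  by_cases hpos : eLpNorm (fun x => ⟪u, x⟫_ℝ - a) 2 (positionLaw φ) = ∞
  · simp [hpos, ENNReal.top_mul hmom0]
  by_cases hmom : eLpNorm (fun p => ⟪v, p⟫_ℝ - b) 2 (momentumLaw φ) = ∞
  · simp [hmom, ENNReal.mul_top hpos0]
  exact enorm_inner_mul_enorm_sq_le_of_memLp u v ⟨by fun_prop, Ne.lt_top hpos⟩
    ⟨by fun_prop, Ne.lt_top hmom⟩

theorem eLpNorm_two_sq {α E : Type*} [MeasurableSpace α] [NormedAddCommGroup E] (f : α → E)
    (μ : Measure α) : eLpNorm f 2 μ ^ 2 = ∫⁻ x, ‖f x‖ₑ ^ 2 ∂μ := by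
  rw [eLpNorm_eq_lintegral_rpow_enorm_toReal two_ne_zero ENNReal.ofNat_ne_top,
    ← ENNReal.rpow_natCast, ← ENNReal.rpow_mul]
  simp

theorem tsum_mul_sq_le_tsum_sq_mul_tsum_sq {ι : Type*} (f g : ι → ℝ≥0∞) :
    (∑' i, f i * g i) ^ 2 ≤ (∑' i, f i ^ 2) * ∑' i, g i ^ 2 := by
  let _ : MeasurableSpace ι := ⊤
  have h := ENNReal.lintegral_mul_le_Lp_mul_Lq (Measure.count (α := ι))
    Real.HolderConjugate.two_two (measurable_from_top.aemeasurable (f := f))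
    (measurable_from_top.aemeasurable (f := g))
  simp only [lintegral_count, Pi.mul_apply, ENNReal.rpow_two] at h
  refine (pow_le_pow_left₀ zero_le h 2).trans_eq ?_
  rw [mul_pow, ← ENNReal.rpow_natCast, ← ENNReal.rpow_natCast, ← ENNReal.rpow_mul,
    ← ENNReal.rpow_mul]
  norm_num

theorem one_le_four_mul_lintegral_mul_lintegral {ι : Type*} {φ : ι → L2 V}
    (hφ : ∑' i, ‖φ i‖ₑ ^ 2 = 1) {u v : V} (huv : ‖⟪u, v⟫_ℝ‖ = 1) (a b : ℝ) :
    1 ≤ 4 * ((∫⁻ x, ‖⟪u, x⟫_ℝ - a‖ₑ ^ 2 ∂Measure.sum fun i => positionLaw (φ i)) *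
      ∫⁻ p, ‖⟪v, p⟫_ℝ - b‖ₑ ^ 2 ∂Measure.sum fun i => momentumLaw (φ i)) := by
  have hsum : (1 : ℝ≥0∞) ≤ 2 * ∑' i, eLpNorm (fun x => ⟪u, x⟫_ℝ - a) 2 (positionLaw (φ i)) *
      eLpNorm (fun p => ⟪v, p⟫_ℝ - b) 2 (momentumLaw (φ i)) := by
    rw [← ENNReal.tsum_mul_left, ← hφ]
    refine ENNReal.tsum_le_tsum fun i => ?_
    simpa [← ofReal_norm, huv] using
      enorm_inner_mul_enorm_sq_le_two_mul_eLpNorm_mul_eLpNorm u v a b (φ i)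
  calc (1 : ℝ≥0∞) ≤ (2 * ∑' i, eLpNorm (fun x => ⟪u, x⟫_ℝ - a) 2 (positionLaw (φ i)) *
        eLpNorm (fun p => ⟪v, p⟫_ℝ - b) 2 (momentumLaw (φ i))) ^ 2 := one_le_pow₀ hsum
    _ ≤ _ := by
        rw [mul_pow, lintegral_sum_measure, lintegral_sum_measure,
          show (2 : ℝ≥0∞) ^ 2 = 4 by norm_num]
        simp only [← eLpNorm_two_sq]
        gcongr
        exact tsum_mul_sq_le_tsum_sq_mul_tsum_sq _ _

end Uncertainty

section Convolution

instance isProbabilityMeasure_neg {M : Type*} [MeasurableSpace M] [Neg M] [MeasurableNeg M]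
    (m : Measure M) [IsProbabilityMeasure m] :
    IsProbabilityMeasure m.neg :=
  Measure.isProbabilityMeasure_map measurable_neg.aemeasurable

variable {M : Type*} [MeasurableSpace M] [AddMonoid M] [MeasurableAdd₂ M]

theorem conv_univ (ν m : Measure M) [IsProbabilityMeasure m] : (ν ∗ m) univ = ν univ := by
  rw [Measure.conv, Measure.map_apply (by fun_prop) .univ, preimage_univ, ← univ_prod_univ,
    Measure.prod_prod, measure_univ (μ := m), mul_one]

theorem conv_sum {ι : Type*} [Countable ι] (ν : Measure M) (μ : ι → Measure M)
    [∀ i, SFinite (μ i)] : ν ∗ Measure.sum μ = Measure.sum fun i => ν ∗ μ i := by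
  rw [Measure.conv, Measure.prod_sum_right, Measure.map_sum (by fun_prop)]
  rfl

theorem sum_conv {ι : Type*} (μ : ι → Measure M) (ν : Measure M) [SFinite ν] :
    Measure.sum μ ∗ ν = Measure.sum fun i => μ i ∗ ν := by
  rw [Measure.conv, Measure.prod_sum_left, Measure.map_sum (by fun_prop)]
  rfl

end Convolution

section Smearing

variable {ν : Measure ℝ} {X : Set ℝ}

theorem measurable_smear (m : Measure ℝ) [SFinite m] (hX : MeasurableSet X) :
    Measurable (smear m X) := by
  have h : MeasurableSet {z : ℝ × ℝ | z.1 - z.2 ∈ X} := measurableSet_preimage (by fun_prop) hX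
  exact Complex.measurable_ofReal.comp (measurable_measure_prodMk_left h).ennreal_toReal

theorem memLp_smear (m : Measure ℝ) [IsFiniteMeasure m] (hX : MeasurableSet X) :
    MemLp (smear m X) ∞ ν := by
  refine memLp_top_of_bound (measurable_smear m hX).aestronglyMeasurable (m.real univ)
    (ae_of_all _ fun x => ?_)
  rw [smear, Complex.norm_real, Real.norm_of_nonneg measureReal_nonneg]
  exact measureReal_mono (subset_univ _)

theorem conv_neg_apply (ν m : Measure ℝ) [SFinite m] (hX : MeasurableSet X) :
    (ν ∗ m.neg) X = ∫⁻ x, m {y | x - y ∈ X} ∂ν := by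
  rw [← lintegral_indicator_one hX, Measure.lintegral_conv (measurable_one.indicator hX)]
  refine lintegral_congr fun x => ?_
  have h : MeasurableSet {y | x + y ∈ X} := measurableSet_preimage (by fun_prop) hX
  change ∫⁻ y, {y | x + y ∈ X}.indicator 1 y ∂m.neg = _
  rw [lintegral_indicator_one h, Measure.neg_apply]
  simp [sub_eq_add_neg]

theorem integral_smear (ν m : Measure ℝ) [IsFiniteMeasure m] (hX : MeasurableSet X) :
    ∫ x, smear m X x ∂ν = ((ν ∗ m.neg).real X : ℂ) := by
  have h : MeasurableSet {z : ℝ × ℝ | z.1 - z.2 ∈ X} := measurableSet_preimage (by fun_prop) hX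
  simp only [smear, Measure.real]
  rw [integral_complex_ofReal, conv_neg_apply ν m hX]
  exact congrArg _ (integral_toReal (measurable_measure_prodMk_left h).aemeasurable
    (ae_of_all _ fun x => measure_lt_top m _))

end Smearing

section OutcomeLaws

variable {A E F : Set ℝ → (L2 ℝ →L[ℂ] L2 ℝ)} {D : L2 ℝ → Measure ℝ} {e f : Measure ℝ}

/-- `D ψ` is the distribution of the outcomes of the observable `A` in the pure state `ψ`. Vectors
of arbitrary norm are admitted; the total mass is then `‖ψ‖²`. -/
structure HasOutcomeLaws (A : Set ℝ → (L2 ℝ →L[ℂ] L2 ℝ)) (D : L2 ℝ → Measure ℝ) : Prop where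
  apply_univ : ∀ ψ, D ψ univ = ‖ψ‖ₑ ^ 2
  inner_apply : ∀ X, MeasurableSet X → ∀ ψ, ⟪ψ, A X ψ⟫_ℂ = ((D ψ).real X : ℂ)

theorem hasOutcomeLaws_idealPosition : HasOutcomeLaws idealPosition positionLaw where
  apply_univ := positionLaw_univ
  inner_apply _ hX ψ := inner_posFun_chi hX ψ

theorem hasOutcomeLaws_idealMomentum : HasOutcomeLaws idealMomentum momentumLaw where
  apply_univ := momentumLaw_univ
  inner_apply _ hX ψ := inner_momFun_chi hX ψ

theorem IsPositionNoise.hasOutcomeLaws (h : IsPositionNoise E e) :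
    HasOutcomeLaws E fun ψ => positionLaw ψ ∗ e.neg where
  apply_univ ψ := by
    have := h.1
    rw [conv_univ, positionLaw_univ]
  inner_apply X hX ψ := by
    have := h.1
    rw [h.2 X hX, inner_posFun (memLp_smear e hX), integral_smear _ _ hX]

theorem IsMomentumNoise.hasOutcomeLaws (h : IsMomentumNoise F f) :
    HasOutcomeLaws F fun ψ => momentumLaw ψ ∗ f.neg where
  apply_univ ψ := by
    have := h.1
    rw [conv_univ, momentumLaw_univ]
  inner_apply X hX ψ := by
    have := h.1
    rw [h.2 X hX, inner_momFun (memLp_smear f hX), integral_smear _ _ hX]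

theorem isPositionNoise_of_inner_eq [IsProbabilityMeasure e]
    (h : ∀ X, MeasurableSet X → ∀ ψ, ‖ψ‖ = 1 →
      ⟪ψ, E X ψ⟫_ℂ = ((positionLaw ψ ∗ e.neg).real X : ℂ)) : IsPositionNoise E e :=
  ⟨‹_›, fun X hX => eq_of_forall_unit_inner_self_eq fun ψ hψ => by
    rw [h X hX ψ hψ, inner_posFun (memLp_smear e hX), integral_smear _ _ hX]⟩

theorem isMomentumNoise_of_inner_eq [IsProbabilityMeasure f]
    (h : ∀ Y, MeasurableSet Y → ∀ ψ, ‖ψ‖ = 1 →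
      ⟪ψ, F Y ψ⟫_ℂ = ((momentumLaw ψ ∗ f.neg).real Y : ℂ)) : IsMomentumNoise F f :=
  ⟨‹_›, fun Y hY => eq_of_forall_unit_inner_self_eq fun ψ hψ => by
    rw [h Y hY ψ hψ, inner_momFun (memLp_smear f hY), integral_smear _ _ hY]⟩

theorem HasOutcomeLaws.isProbabilityMeasure (h : HasOutcomeLaws A D) {ψ : L2 ℝ} (hψ : ‖ψ‖ = 1) :
    IsProbabilityMeasure (D ψ) :=
  ⟨by rw [h.apply_univ, ← ofReal_norm, hψ, ENNReal.ofReal_one, one_pow]⟩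

theorem HasOutcomeLaws.unique {D' : L2 ℝ → Measure ℝ} (h : HasOutcomeLaws A D)
    (h' : HasOutcomeLaws A D') {ψ : L2 ℝ} (hψ : ‖ψ‖ = 1) : D ψ = D' ψ := by
  have := h.isProbabilityMeasure hψ
  have := h'.isProbabilityMeasure hψ
  ext X hX
  have hreal : (D ψ).real X = (D' ψ).real X :=
    Complex.ofReal_injective ((h.inner_apply X hX ψ).symm.trans (h'.inner_apply X hX ψ))
  rwa [measureReal_eq_measureReal_iff] at hreal

theorem HasOutcomeLaws.isOutcomeLaw_pureState (h : HasOutcomeLaws A D) {ψ : L2 ℝ} (hψ : ‖ψ‖ = 1) :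
    IsOutcomeLaw A (pureState ψ hψ) (D ψ) :=
  ⟨h.isProbabilityMeasure hψ, fun X hX => by rw [trace_pureState_comp, h.inner_apply X hX]⟩

theorem hasSum_measureReal_sum {α ι : Type*} [MeasurableSpace α] (μ : ι → Measure α)
    [IsFiniteMeasure (Measure.sum μ)] {X : Set α} (hX : MeasurableSet X) :
    HasSum (fun i => (μ i).real X) ((Measure.sum μ).real X) := by
  have hfin : ∑' i, μ i X ≠ ∞ := Measure.sum_apply μ hX ▸ measure_ne_top (Measure.sum μ) X
  rw [Measure.real, Measure.sum_apply μ hX,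
    ENNReal.tsum_toReal_eq (ENNReal.ne_top_of_tsum_ne_top hfin)]
  exact (ENNReal.summable_toReal hfin).hasSum

theorem HasOutcomeLaws.isOutcomeLaw_eq_sum (h : HasOutcomeLaws A D) {ρ : DensityOperator (L2 ℝ)}
    {α : Measure ℝ} (hα : IsOutcomeLaw A ρ α) {ι : Type*} {φ : ι → L2 ℝ} (hφ : ρ.IsEnsemble φ) :
    α = Measure.sum fun i => D (φ i) := by
  have := hα.1
  have hmass : (Measure.sum fun i => D (φ i)) univ = 1 := by
    simp only [Measure.sum_apply _ MeasurableSet.univ, h.apply_univ, hφ.tsum_enorm_sq]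
  have : IsFiniteMeasure (Measure.sum fun i => D (φ i)) := ⟨hmass ▸ ENNReal.one_lt_top⟩
  ext X hX
  rw [← measureReal_eq_measureReal_iff]
  have htrace := hφ.hasSum_trace_comp (A X)
  simp only [h.inner_apply X hX, hα.2 X hX, Complex.hasSum_ofReal] at htrace
  exact htrace.unique (hasSum_measureReal_sum _ hX)

end OutcomeLaws

section MeasuredObservable

variable {ι : Type*} {σ : DensityOperator (L2 ProbeConf)} {φ : ι → L2 ProbeConf}
  {G : Set ℝ → Set ℝ → (L2 ℝ →L[ℂ] L2 ℝ)} {X Y : Set ℝ} {lam mu kap : ℝ}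

theorem norm_tensor_le (ψ : L2 ℝ) (φ : L2 ProbeConf) : ‖tensor ψ φ‖ ≤ ‖φ‖ * ‖ψ‖ :=
  (norm_tensor ψ φ).le.trans (mul_comm _ _).le

/-- The bounded operator `ψ ↦ ψ ⊗ φ`, which adds a probe in the pure state `φ` to the system. -/
def tensorRight (φ : L2 ProbeConf) : L2 ℝ →L[ℂ] L2 TotalConf :=
  LinearMap.mkContinuous
    { toFun := fun ψ => tensor ψ φ
      map_add' := fun ψ₁ ψ₂ => by
        rw [tensor, tensor, tensor, ← MemLp.toLp_add]
        apply MemLp.toLp_congr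
        filter_upwards [tendsto_fst_splitConf.eventually (Lp.coeFn_add ψ₁ ψ₂)] with x hx
        simp only [hx, Pi.add_apply, add_mul]
      map_smul' := fun c ψ => by
        rw [tensor, tensor, RingHom.id_apply, ← MemLp.toLp_const_smul]
        apply MemLp.toLp_congr
        filter_upwards [tendsto_fst_splitConf.eventually (Lp.coeFn_smul c ψ)] with x hx
        simp only [hx, Pi.smul_apply, smul_eq_mul, mul_assoc] }
    ‖φ‖ (fun ψ => norm_tensor_le ψ φ)

theorem norm_tensorRight_le (φ : L2 ProbeConf) : ‖tensorRight φ‖ ≤ ‖φ‖ :=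
  LinearMap.mkContinuous_norm_le _ (norm_nonneg φ) _

theorem DensityOperator.IsEnsemble.hasSum_trace_coupling (hφ : σ.IsEnsemble φ) (lam mu kap : ℝ)
    (ψ : L2 ℝ) (B : L2 TotalConf →L[ℂ] L2 TotalConf) :
    HasSum (fun i => ⟪coupling lam mu kap (tensor ψ (φ i)),
        B (coupling lam mu kap (tensor ψ (φ i)))⟫_ℂ)
      (trace ((coupling lam mu kap ∘L productState ψ σ.op ∘L (coupling lam mu kap).adjoint) ∘L
        B)) := by
  have h := hφ.hasSum_trace_conj_comp (coupling lam mu kap ∘L tensorLeft ψ) B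
  rw [ContinuousLinearMap.adjoint_comp] at h
  exact h

theorem summable_adjoint_tensorRight_comp (hφ : Summable fun i => ‖φ i‖ ^ 2)
    (C : L2 TotalConf →L[ℂ] L2 TotalConf) :
    Summable fun i => (tensorRight (φ i)).adjoint ∘L C ∘L tensorRight (φ i) := by
  refine Summable.of_norm_bounded (hφ.mul_left ‖C‖) fun i => ?_
  have hT := norm_tensorRight_le (φ i)
  calc ‖(tensorRight (φ i)).adjoint ∘L C ∘L tensorRight (φ i)‖
      ≤ ‖(tensorRight (φ i)).adjoint‖ * (‖C‖ * ‖tensorRight (φ i)‖) :=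
        (ContinuousLinearMap.opNorm_comp_le _ _).trans <|
          mul_le_mul_of_nonneg_left (ContinuousLinearMap.opNorm_comp_le _ _) (norm_nonneg _)
    _ ≤ ‖φ i‖ * (‖C‖ * ‖φ i‖) := by
        rw [LinearIsometryEquiv.norm_map]
        gcongr
    _ = ‖C‖ * ‖φ i‖ ^ 2 := by ring

theorem exists_inner_eq_trace_coupling (lam mu kap : ℝ) (σ : DensityOperator (L2 ProbeConf))
    (B : L2 TotalConf →L[ℂ] L2 TotalConf) :
    ∃ T : L2 ℝ →L[ℂ] L2 ℝ, ∀ ψ, ⟪ψ, T ψ⟫_ℂ = trace ((coupling lam mu kap ∘L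
      productState ψ σ.op ∘L (coupling lam mu kap).adjoint) ∘L B) := by
  obtain ⟨ι, _, φ, hφ⟩ := σ.exists_isEnsemble
  have hsum := (summable_adjoint_tensorRight_comp hφ.hasSum_norm_sq.summable
    ((coupling lam mu kap).adjoint ∘L B ∘L coupling lam mu kap)).hasSum
  refine ⟨_, fun ψ => HasSum.unique ((hsum.mapL (ContinuousLinearMap.apply ℂ (L2 ℝ) ψ)).mapL
    (innerSL ℂ ψ)) ?_⟩
  convert! hφ.hasSum_trace_coupling lam mu kap ψ B using 2 with i
  simp only [ContinuousLinearMap.apply_apply, ContinuousLinearMap.comp_apply,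
    innerSL_apply_apply, ContinuousLinearMap.adjoint_inner_right]
  rfl

theorem exists_isEffectiveObservable (lam mu kap : ℝ) (σ : DensityOperator (L2 ProbeConf)) :
    ∃ G, IsEffectiveObservable lam mu kap σ G := by
  choose T hT using exists_inner_eq_trace_coupling lam mu kap σ
  exact ⟨fun X Y => T (probePosition ((fun x => lam * x) '' X) ∘L
    probeMomentum ((fun y => mu * y) '' Y)), fun X Y _ _ ψ _ => hT _ ψ⟩

theorem image_mul_left_eq_preimage_div {c : ℝ} (hc : c ≠ 0) (X : Set ℝ) :
    (fun x => c * x) '' X = (fun x => x / c) ⁻¹' X :=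
  congrFun (image_eq_preimage_of_inverse (fun x => mul_div_cancel_left₀ x hc)
    fun x => mul_div_cancel₀ x hc) X

theorem inner_probePosition (hlam : lam ≠ 0) (hX : MeasurableSet X) (Φ : L2 TotalConf) :
    ⟪Φ, probePosition ((fun x => lam * x) '' X) Φ⟫_ℂ =
      (((positionLaw Φ).map fun x => x 1 / lam).real X : ℂ) := by
  have hpre : MeasurableSet ((fun x : TotalConf => x 1 / lam) ⁻¹' X) :=
    measurableSet_preimage (by fun_prop) hX
  rw [image_mul_left_eq_preimage_div hlam, probePosition, map_measureReal_apply (by fun_prop) hX]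
  exact inner_posFun_chi hpre Φ

theorem inner_probeMomentum (hmu : mu ≠ 0) (hY : MeasurableSet Y) (Φ : L2 TotalConf) :
    ⟪Φ, probeMomentum ((fun y => mu * y) '' Y) Φ⟫_ℂ =
      (((momentumLaw Φ).map fun p => p 2 / mu).real Y : ℂ) := by
  have hpre : MeasurableSet ((fun p : TotalConf => p 2 / mu) ⁻¹' Y) :=
    measurableSet_preimage (by fun_prop) hY
  rw [image_mul_left_eq_preimage_div hmu, probeMomentum, map_measureReal_apply (by fun_prop) hY]
  exact inner_momFun_chi hpre Φ

theorem probePosition_image_univ (hlam : lam ≠ 0) :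
    probePosition ((fun x => lam * x) '' univ) = ContinuousLinearMap.id ℂ (L2 TotalConf) := by
  rw [image_mul_left_eq_preimage_div hlam]
  exact posFun_chi_univ

theorem probeMomentum_image_univ (hmu : mu ≠ 0) :
    probeMomentum ((fun y => mu * y) '' univ) = ContinuousLinearMap.id ℂ (L2 TotalConf) := by
  rw [image_mul_left_eq_preimage_div hmu]
  exact momFun_chi_univ

/-- The position noise of the model, for a probe in the state `∑ᵢ |φᵢ⟩⟨φᵢ|`. The sign comes from
the convolution `χ_X * e`, which subtracts the noise from the position. -/
def positionNoise (lam mu kap : ℝ) (φ : ι → L2 ProbeConf) : Measure ℝ :=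
  (Measure.sum fun i => positionLaw (φ i)).map fun x => -⟪positionNoiseVec lam mu kap, x⟫_ℝ

/-- The momentum noise of the model, for a probe in the state `∑ᵢ |φᵢ⟩⟨φᵢ|`, with the sign of
`positionNoise`. -/
def momentumNoise (lam mu kap : ℝ) (φ : ι → L2 ProbeConf) : Measure ℝ :=
  (Measure.sum fun i => momentumLaw (φ i)).map fun p => -⟪momentumNoiseVec lam mu kap, p⟫_ℝ

theorem DensityOperator.IsEnsemble.isProbabilityMeasure_positionNoise (hφ : σ.IsEnsemble φ)
    (lam mu kap : ℝ) : IsProbabilityMeasure (positionNoise lam mu kap φ) := by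
  have : IsProbabilityMeasure (Measure.sum fun i => positionLaw (φ i)) :=
    ⟨by simp only [Measure.sum_apply _ MeasurableSet.univ, positionLaw_univ, hφ.tsum_enorm_sq]⟩
  exact Measure.isProbabilityMeasure_map (by fun_prop)

theorem DensityOperator.IsEnsemble.isProbabilityMeasure_momentumNoise (hφ : σ.IsEnsemble φ)
    (lam mu kap : ℝ) : IsProbabilityMeasure (momentumNoise lam mu kap φ) := by
  have : IsProbabilityMeasure (Measure.sum fun i => momentumLaw (φ i)) :=
    ⟨by simp only [Measure.sum_apply _ MeasurableSet.univ, momentumLaw_univ, hφ.tsum_enorm_sq]⟩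
  exact Measure.isProbabilityMeasure_map (by fun_prop)

theorem neg_positionNoise (lam mu kap : ℝ) (φ : ι → L2 ProbeConf) :
    (positionNoise lam mu kap φ).neg =
      Measure.sum fun i => (positionLaw (φ i)).map (⟪positionNoiseVec lam mu kap, ·⟫_ℝ) := by
  rw [positionNoise, Measure.neg_def, Measure.map_map measurable_neg (by fun_prop),
    Measure.map_sum (by fun_prop)]
  simp only [Function.comp_def, neg_neg]

theorem neg_momentumNoise (lam mu kap : ℝ) (φ : ι → L2 ProbeConf) :
    (momentumNoise lam mu kap φ).neg =
      Measure.sum fun i => (momentumLaw (φ i)).map (⟪momentumNoiseVec lam mu kap, ·⟫_ℝ) := by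
  rw [momentumNoise, Measure.neg_def, Measure.map_map measurable_neg (by fun_prop),
    Measure.map_sum (by fun_prop)]
  simp only [Function.comp_def, neg_neg]

theorem IsEffectiveObservable.isPositionNoise [Countable ι] (hlam : lam ≠ 0)
    (hmu : mu ≠ 0) (hG : IsEffectiveObservable lam mu kap σ G) (hφ : σ.IsEnsemble φ) :
    IsPositionNoise (fun X => G X univ) (positionNoise lam mu kap φ) := by
  have := hφ.isProbabilityMeasure_positionNoise lam mu kap
  refine isPositionNoise_of_inner_eq fun X hX ψ hψ => ?_
  have hsum : positionLaw ψ ∗ (positionNoise lam mu kap φ).neg =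
      Measure.sum fun i => (positionLaw (coupling lam mu kap (tensor ψ (φ i)))).map
        fun x => x 1 / lam := by
    simp only [map_positionLaw_coupling_tensor hlam, neg_positionNoise, conv_sum]
  have htrace := hφ.hasSum_trace_coupling lam mu kap ψ (probePosition ((fun x => lam * x) '' X))
  simp only [inner_probePosition hlam hX] at htrace
  rw [hG X univ hX .univ ψ hψ, probeMomentum_image_univ hmu, ContinuousLinearMap.comp_id]
  have : IsFiniteMeasure (Measure.sum fun i =>
    (positionLaw (coupling lam mu kap (tensor ψ (φ i)))).map fun x => x 1 / lam) :=
    hsum ▸ inferInstance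
  rw [hsum]
  exact htrace.unique (Complex.hasSum_ofReal.2 (hasSum_measureReal_sum _ hX))

theorem IsEffectiveObservable.isMomentumNoise [Countable ι] (hlam : lam ≠ 0)
    (hmu : mu ≠ 0) (hG : IsEffectiveObservable lam mu kap σ G) (hφ : σ.IsEnsemble φ) :
    IsMomentumNoise (fun Y => G univ Y) (momentumNoise lam mu kap φ) := by
  have := hφ.isProbabilityMeasure_momentumNoise lam mu kap
  refine isMomentumNoise_of_inner_eq fun Y hY ψ hψ => ?_
  have hsum : momentumLaw ψ ∗ (momentumNoise lam mu kap φ).neg =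
      Measure.sum fun i => (momentumLaw (coupling lam mu kap (tensor ψ (φ i)))).map
        fun p => p 2 / mu := by
    simp only [map_momentumLaw_coupling_tensor _ hmu, neg_momentumNoise, conv_sum]
  have htrace := hφ.hasSum_trace_coupling lam mu kap ψ (probeMomentum ((fun y => mu * y) '' Y))
  simp only [inner_probeMomentum hmu hY] at htrace
  rw [hG univ Y .univ hY ψ hψ, probePosition_image_univ hlam, ContinuousLinearMap.id_comp]
  have : IsFiniteMeasure (Measure.sum fun i =>
    (momentumLaw (coupling lam mu kap (tensor ψ (φ i)))).map fun p => p 2 / mu) :=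
    hsum ▸ inferInstance
  rw [hsum]
  exact htrace.unique (Complex.hasSum_ofReal.2 (hasSum_measureReal_sum _ hY))

end MeasuredObservable

section Wasserstein

variable {β : Measure ℝ}

theorem ofReal_sq_eq_enorm_sq (x : ℝ) : ENNReal.ofReal (x ^ 2) = ‖x‖ₑ ^ 2 := by
  rw [← enorm_pow, Real.enorm_of_nonneg (sq_nonneg x)]

theorem secondMoment_eq_eLpNorm_sq (m : Measure ℝ) : secondMoment m = eLpNorm id 2 m ^ 2 := by
  simp only [eLpNorm_two_sq, secondMoment, ofReal_sq_eq_enorm_sq, id]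

theorem wasserstein_eq_iInf_eLpNorm (α β : Measure ℝ) : wasserstein α β =
    ⨅ (γ : Measure (ℝ × ℝ)) (_ : γ.map Prod.fst = α ∧ γ.map Prod.snd = β),
      eLpNorm (fun z : ℝ × ℝ => z.1 - z.2) 2 γ := by
  simp only [wasserstein, sq_abs, ofReal_sq_eq_enorm_sq, ← eLpNorm_two_sq]
  simp only [← ENNReal.rpow_natCast, ← ENNReal.rpow_mul, Nat.cast_ofNat, mul_one_div_cancel,
    ne_eq, OfNat.ofNat_ne_zero, not_false_eq_true, ENNReal.rpow_one]

theorem eLpNorm_id_map {α : Type*} [MeasurableSpace α] {γ : Measure α} {f : α → ℝ}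
    (hf : Measurable f) : eLpNorm id 2 (γ.map f) = eLpNorm f 2 γ :=
  eLpNorm_map_measure aestronglyMeasurable_id hf.aemeasurable

theorem eLpNorm_id_neg (m : Measure ℝ) : eLpNorm id 2 m.neg = eLpNorm id 2 m := by
  rw [Measure.neg_def, eLpNorm_id_map measurable_neg]
  exact eLpNorm_neg id 2 m

theorem eLpNorm_fst_prod (β m : Measure ℝ) [IsProbabilityMeasure m] :
    eLpNorm (Prod.fst : ℝ × ℝ → ℝ) 2 (β.prod m) = eLpNorm id 2 β := by
  rw [← eLpNorm_id_map measurable_fst, Measure.map_fst_prod, measure_univ, one_smul]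

theorem eLpNorm_snd_prod (β m : Measure ℝ) [IsProbabilityMeasure β] [SFinite m] :
    eLpNorm (Prod.snd : ℝ × ℝ → ℝ) 2 (β.prod m) = eLpNorm id 2 m := by
  rw [← eLpNorm_id_map measurable_snd, Measure.map_snd_prod, measure_univ, one_smul]

theorem wasserstein_conv_le (β m : Measure ℝ) [IsProbabilityMeasure β] [IsProbabilityMeasure m] :
    wasserstein (β ∗ m) β ≤ eLpNorm id 2 m := by
  rw [wasserstein_eq_iInf_eLpNorm]
  refine iInf₂_le_of_le ((β.prod m).map fun z => (z.1 + z.2, z.1)) ⟨?_, ?_⟩ (le_of_eq ?_)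
  · rw [Measure.map_map measurable_fst (by fun_prop)]
    rfl
  · rw [Measure.map_map measurable_snd (by fun_prop)]
    exact measurePreserving_fst.map_eq
  · rw [eLpNorm_map_measure (by fun_prop) (by fun_prop), ← eLpNorm_snd_prod β m]
    simp only [Function.comp_def, add_sub_cancel_left]

theorem eLpNorm_id_le_wasserstein_add (α β : Measure ℝ) :
    eLpNorm id 2 α ≤ wasserstein α β + eLpNorm id 2 β := by
  simp only [wasserstein_eq_iInf_eLpNorm, ENNReal.iInf_add]
  refine le_iInf₂ fun γ hγ => ?_
  rw [← hγ.1, ← hγ.2, eLpNorm_id_map measurable_fst, eLpNorm_id_map measurable_snd]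
  calc eLpNorm Prod.fst 2 γ = eLpNorm ((fun z : ℝ × ℝ => z.1 - z.2) + Prod.snd) 2 γ :=
        congrArg (eLpNorm · 2 γ) (funext fun z => (sub_add_cancel z.1 z.2).symm)
    _ ≤ eLpNorm (fun z : ℝ × ℝ => z.1 - z.2) 2 γ + eLpNorm Prod.snd 2 γ :=
        eLpNorm_add_le (by fun_prop) (by fun_prop) one_le_two

theorem eLpNorm_id_le_eLpNorm_conv_add (β m : Measure ℝ) [IsProbabilityMeasure β]
    [IsProbabilityMeasure m] : eLpNorm id 2 m ≤ eLpNorm id 2 (β ∗ m) + eLpNorm id 2 β := by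
  rw [Measure.conv, eLpNorm_id_map (by fun_prop), ← eLpNorm_fst_prod β m, ← eLpNorm_snd_prod β m]
  calc eLpNorm Prod.snd 2 (β.prod m)
      = eLpNorm ((fun z : ℝ × ℝ => z.1 + z.2) - Prod.fst) 2 (β.prod m) :=
        congrArg (eLpNorm · 2 (β.prod m)) (funext fun z => (add_sub_cancel_left z.1 z.2).symm)
    _ ≤ eLpNorm (fun z : ℝ × ℝ => z.1 + z.2) 2 (β.prod m) + eLpNorm Prod.fst 2 (β.prod m) :=
        eLpNorm_sub_le (by fun_prop) (by fun_prop) one_le_two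

theorem eLpNorm_id_le_wasserstein_conv_add (β m : Measure ℝ) [IsProbabilityMeasure β]
    [IsProbabilityMeasure m] :
    eLpNorm id 2 m ≤ wasserstein (β ∗ m) β + 2 * eLpNorm id 2 β :=
  calc eLpNorm id 2 m ≤ eLpNorm id 2 (β ∗ m) + eLpNorm id 2 β :=
        eLpNorm_id_le_eLpNorm_conv_add β m
    _ ≤ wasserstein (β ∗ m) β + eLpNorm id 2 β + eLpNorm id 2 β := by
        gcongr
        exact eLpNorm_id_le_wasserstein_add _ β
    _ = wasserstein (β ∗ m) β + 2 * eLpNorm id 2 β := by ring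

theorem charFun_ne_zero_of_ae_abs_le [IsProbabilityMeasure β] {ε t : ℝ}
    (h : ∀ᵐ x ∂β, |x| ≤ ε) (ht : |t| * ε < 1) : charFun β t ≠ 0 := by
  have hint : Integrable (fun x : ℝ => Complex.exp (t * x * Complex.I)) β :=
    Integrable.of_bound (by fun_prop) 1 (ae_of_all _ fun x => by
      rw [← Complex.ofReal_mul, Complex.norm_exp_ofReal_mul_I])
  have hsub : charFun β t - 1 = ∫ x, (Complex.exp (t * x * Complex.I) - 1) ∂β := by
    rw [integral_sub hint (integrable_const 1), charFun_apply_real]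
    simp
  have hbound : ‖charFun β t - 1‖ ≤ |t| * ε := by
    rw [hsub]
    refine (norm_integral_le_of_norm_le_const (C := |t| * ε) ?_).trans_eq (by simp)
    filter_upwards [h] with x hx
    have hexp := Real.norm_exp_I_mul_ofReal_sub_one_le (x := t * x)
    rw [Real.norm_eq_abs, abs_mul, Complex.ofReal_mul, mul_comm Complex.I] at hexp
    exact hexp.trans (by gcongr)
  intro h0
  rw [h0, zero_sub, norm_neg, norm_one] at hbound
  exact hbound.not_gt ht

end Wasserstein

section Noise

variable {A B E F : Set ℝ → (L2 ℝ →L[ℂ] L2 ℝ)} {D : L2 ℝ → Measure ℝ} {e e' f f' m m' : Measure ℝ}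

/-- The distributions `D ψ` of the values of a quantity in the states `ψ` can be concentrated near
`0`. Tested in such states, an additive noise becomes visible. -/
def IsSharpAtZero (D : L2 ℝ → Measure ℝ) : Prop :=
  ∀ ε : ℝ, 0 < ε → ∃ ψ, ‖ψ‖ = 1 ∧ ∀ᵐ x ∂D ψ, |x| ≤ ε

theorem isSharpAtZero_positionLaw : IsSharpAtZero positionLaw := by
  intro ε hε
  have hfin : volume (Icc (-ε) ε) ≠ ∞ := measure_Icc_lt_top.ne
  set χ : L2 ℝ := indicatorConstLp 2 measurableSet_Icc hfin (1 : ℂ) with hχ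
  have hnorm : ‖χ‖ ≠ 0 := by
    rw [hχ, norm_indicatorConstLp two_ne_zero ENNReal.ofNat_ne_top, Real.volume_real_Icc, norm_one,
      one_mul]
    exact (Real.rpow_pos_of_pos (lt_max_of_lt_left (by linarith)) _).ne'
  refine ⟨((‖χ‖⁻¹ : ℝ) : ℂ) • χ, ?_, ?_⟩
  · rw [norm_smul, Complex.norm_real, norm_inv, norm_norm, inv_mul_cancel₀ hnorm]
  · rw [positionLaw, ae_withDensity_iff' (aemeasurable_enorm_sq _)]
    filter_upwards [Lp.coeFn_smul ((‖χ‖⁻¹ : ℝ) : ℂ) χ, indicatorConstLp_coeFn_notMem (p := 2)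
      (hs := measurableSet_Icc) (hμs := hfin) (c := (1 : ℂ))] with x hsmul hχx hne
    by_contra hx
    refine hne ?_
    rw [hsmul, Pi.smul_apply, hχ, hχx fun h => hx (abs_le.2 h), smul_zero, enorm_zero,
      zero_pow two_ne_zero]

theorem isSharpAtZero_momentumLaw : IsSharpAtZero momentumLaw := by
  intro ε hε
  obtain ⟨χ, hχ, hsharp⟩ := isSharpAtZero_positionLaw (ε / (2 * Real.pi)) (by positivity)
  refine ⟨fourierInvOp χ, by rw [← norm_fourierOp, fourierOp_fourierInvOp, hχ], ?_⟩
  rw [momentumLaw, fourierOp_fourierInvOp,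
    ae_map_iff (by fun_prop) (measurableSet_le (by fun_prop) (by fun_prop))]
  filter_upwards [hsharp] with x hx
  rw [smul_eq_mul, abs_mul, abs_of_pos Real.two_pi_pos]
  exact (le_div_iff₀' Real.two_pi_pos).1 hx

theorem IsSharpAtZero.conv_cancel [IsProbabilityMeasure m] [IsProbabilityMeasure m']
    (hD : IsSharpAtZero D) (hprob : ∀ ψ, ‖ψ‖ = 1 → IsProbabilityMeasure (D ψ))
    (h : ∀ ψ, ‖ψ‖ = 1 → D ψ ∗ m = D ψ ∗ m') : m = m' := by
  refine Measure.ext_of_charFun (funext fun t => ?_)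
  obtain ⟨ψ, hψ, hsharp⟩ := hD (1 / (|t| + 1)) (by positivity)
  have := hprob ψ hψ
  have hlt : |t| * (1 / (|t| + 1)) < 1 := by
    rw [mul_one_div, div_lt_one (by positivity)]
    exact lt_add_one _
  have hchar := congrArg (charFun · t) (h ψ hψ)
  simp only [charFun_conv] at hchar
  exact mul_left_cancel₀ (charFun_ne_zero_of_ae_abs_le hsharp hlt) hchar

theorem HasOutcomeLaws.noise_unique [IsProbabilityMeasure m] [IsProbabilityMeasure m']
    (hB : HasOutcomeLaws B D) (hD : IsSharpAtZero D) (h : HasOutcomeLaws A fun ψ => D ψ ∗ m.neg)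
    (h' : HasOutcomeLaws A fun ψ => D ψ ∗ m'.neg) : m = m' := by
  have hneg : m.neg = m'.neg :=
    hD.conv_cancel (fun ψ => hB.isProbabilityMeasure) fun ψ hψ => h.unique h' hψ
  rw [← m.neg_neg, hneg, m'.neg_neg]

theorem IsPositionNoise.unique (h : IsPositionNoise E e) (h' : IsPositionNoise E e') : e = e' :=
  have := h.1
  have := h'.1
  hasOutcomeLaws_idealPosition.noise_unique isSharpAtZero_positionLaw h.hasOutcomeLaws
    h'.hasOutcomeLaws

theorem IsMomentumNoise.unique (h : IsMomentumNoise F f) (h' : IsMomentumNoise F f') : f = f' :=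
  have := h.1
  have := h'.1
  hasOutcomeLaws_idealMomentum.noise_unique isSharpAtZero_momentumLaw h.hasOutcomeLaws
    h'.hasOutcomeLaws

theorem HasOutcomeLaws.observableError_le [IsProbabilityMeasure m]
    (hA : HasOutcomeLaws A fun ψ => D ψ ∗ m) (hB : HasOutcomeLaws B D) :
    observableError A B ≤ eLpNorm id 2 m := by
  refine iSup₂_le fun ρ α => iSup₂_le fun β ⟨hα, hβ⟩ => ?_
  obtain ⟨ι, _, φ, hφ⟩ := ρ.exists_isEnsemble
  have hconv : α = β ∗ m := by
    rw [hA.isOutcomeLaw_eq_sum hα hφ, hB.isOutcomeLaw_eq_sum hβ hφ, sum_conv]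
  have := hβ.1
  rw [hconv]
  exact wasserstein_conv_le β m

theorem HasOutcomeLaws.le_observableError [IsProbabilityMeasure m]
    (hA : HasOutcomeLaws A fun ψ => D ψ ∗ m) (hB : HasOutcomeLaws B D) (hD : IsSharpAtZero D) :
    eLpNorm id 2 m ≤ observableError A B := by
  refine ENNReal.le_of_forall_pos_le_add fun ε hε _ => ?_
  obtain ⟨ψ, hψ, hsharp⟩ := hD (ε / 2) (by positivity)
  have := hB.isProbabilityMeasure hψ
  have hle : wasserstein (D ψ ∗ m) (D ψ) ≤ observableError A B :=
    le_iSup₂_of_le (pureState ψ hψ) _ <|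
      le_iSup₂_of_le _ ⟨hA.isOutcomeLaw_pureState hψ, hB.isOutcomeLaw_pureState hψ⟩ le_rfl
  have hsmall : 2 * eLpNorm id 2 (D ψ) ≤ ε := by
    have hbound := eLpNorm_le_of_ae_bound (f := (id : ℝ → ℝ)) (p := 2) hsharp
    rw [measure_univ, ENNReal.one_rpow, one_mul] at hbound
    refine (mul_le_mul_right hbound 2).trans_eq ?_
    rw [← ENNReal.ofReal_ofNat 2, ← ENNReal.ofReal_mul zero_le_two, mul_div_cancel₀ _ two_ne_zero,
      ENNReal.ofReal_coe_nnreal]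
  exact (eLpNorm_id_le_wasserstein_conv_add (D ψ) m).trans (add_le_add hle hsmall)

theorem HasOutcomeLaws.observableError_sq [IsProbabilityMeasure m]
    (hA : HasOutcomeLaws A fun ψ => D ψ ∗ m.neg) (hB : HasOutcomeLaws B D)
    (hD : IsSharpAtZero D) : observableError A B ^ 2 = secondMoment m := by
  rw [le_antisymm (hA.observableError_le hB) (hA.le_observableError hB hD), eLpNorm_id_neg,
    secondMoment_eq_eLpNorm_sq]

theorem IsPositionNoise.observableError_sq (h : IsPositionNoise E e) :
    observableError E idealPosition ^ 2 = secondMoment e :=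
  have := h.1
  h.hasOutcomeLaws.observableError_sq hasOutcomeLaws_idealPosition isSharpAtZero_positionLaw

theorem IsMomentumNoise.observableError_sq (h : IsMomentumNoise F f) :
    observableError F idealMomentum ^ 2 = secondMoment f :=
  have := h.1
  h.hasOutcomeLaws.observableError_sq hasOutcomeLaws_idealMomentum isSharpAtZero_momentumLaw

end Noise

section NoiseUncertainty

variable {ι : Type*} {φ : ι → L2 ProbeConf} {lam mu : ℝ}

theorem lintegral_ofReal_sub_sq_map_neg {α : Type*} [MeasurableSpace α] (ν : Measure α)
    {g : α → ℝ} (hg : Measurable g) (a : ℝ) :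
    ∫⁻ x, ENNReal.ofReal ((x - a) ^ 2) ∂ν.map (fun x => -g x) = ∫⁻ x, ‖g x - -a‖ₑ ^ 2 ∂ν := by
  rw [lintegral_map (by fun_prop) (by fun_prop)]
  refine lintegral_congr fun x => ?_
  rw [ofReal_sq_eq_enorm_sq, ← enorm_neg, neg_sub', neg_neg]

theorem one_div_four_le_lintegral_positionNoise_mul_lintegral_momentumNoise (hlam : lam ≠ 0)
    (hmu : mu ≠ 0) (kap : ℝ) (hφ : ∑' i, ‖φ i‖ₑ ^ 2 = 1) (a b : ℝ) :
    1 / 4 ≤ (∫⁻ x, ENNReal.ofReal ((x - a) ^ 2) ∂positionNoise lam mu kap φ) *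
      ∫⁻ x, ENNReal.ofReal ((x - b) ^ 2) ∂momentumNoise lam mu kap φ := by
  rw [positionNoise, momentumNoise, lintegral_ofReal_sub_sq_map_neg _ (by fun_prop),
    lintegral_ofReal_sub_sq_map_neg _ (by fun_prop)]
  refine ENNReal.div_le_of_le_mul' (one_le_four_mul_lintegral_mul_lintegral hφ ?_ _ _)
  rw [inner_positionNoiseVec_momentumNoiseVec hlam hmu, norm_neg, norm_one]

end NoiseUncertainty

end ArthursKelly

end

open ArthursKelly in
theorem mainTheorem3_general (lam mu kap : ℝ) (hlam : lam ≠ 0) (hmu : mu ≠ 0)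
    (σ : DensityOperator (L2 ProbeConf)) :
    (∃ G, IsEffectiveObservable lam mu kap σ G) ∧
    ∀ G, IsEffectiveObservable lam mu kap σ G →
      (∃ e, IsPositionNoise (fun X => G X univ) e) ∧
      (∃ f, IsMomentumNoise (fun Y => G univ Y) f) ∧
      ∀ e f : Measure ℝ, IsPositionNoise (fun X => G X univ) e →
        IsMomentumNoise (fun Y => G univ Y) f →
        1 / 4 ≤ evariance id e * evariance id f ∧
        1 / 4 ≤ secondMoment e * secondMoment f ∧
        observableError (fun X => G X univ) idealPosition ^ 2 = secondMoment e ∧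
        observableError (fun Y => G univ Y) idealMomentum ^ 2 = secondMoment f ∧
        1 / 2 ≤ observableError (fun X => G X univ) idealPosition *
          observableError (fun Y => G univ Y) idealMomentum := by
  refine ⟨exists_isEffectiveObservable lam mu kap σ, fun G hG => ?_⟩
  obtain ⟨ι, _, φ, hφ⟩ := σ.exists_isEnsemble
  have he₀ := hG.isPositionNoise hlam hmu hφ
  have hf₀ := hG.isMomentumNoise hlam hmu hφ
  refine ⟨⟨_, he₀⟩, ⟨_, hf₀⟩, fun e f he hf => ?_⟩
  have huncertainty : ∀ a b : ℝ, 1 / 4 ≤ (∫⁻ x, ENNReal.ofReal ((x - a) ^ 2) ∂e) *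
      ∫⁻ x, ENNReal.ofReal ((x - b) ^ 2) ∂f := by
    rw [he.unique he₀, hf.unique hf₀]
    exact one_div_four_le_lintegral_positionNoise_mul_lintegral_momentumNoise hlam hmu kap
      hφ.tsum_enorm_sq
  have hmoment : 1 / 4 ≤ secondMoment e * secondMoment f := by
    simpa only [secondMoment, sub_zero] using huncertainty 0 0
  refine ⟨?_, hmoment, he.observableError_sq, hf.observableError_sq, ?_⟩
  · rw [evariance_eq_lintegral_ofReal, evariance_eq_lintegral_ofReal]
    exact huncertainty _ _
  · rw [← ENNReal.pow_le_pow_left_iff two_ne_zero, mul_pow, he.observableError_sq,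
      hf.observableError_sq]
    refine le_of_eq_of_le ?_ hmoment
    rw [one_div, one_div, ← ENNReal.inv_pow]
    norm_num

theorem mainTheorem3 (lam mu kap : ℝ) (hlam : 0 < lam) (hmu : 0 < mu)
    (σ : ArthursKelly.DensityOperator (ArthursKelly.L2 ArthursKelly.ProbeConf)) :
    (∃ G, ArthursKelly.IsEffectiveObservable lam mu kap σ G) ∧
    ∀ G, ArthursKelly.IsEffectiveObservable lam mu kap σ G →
      (∃ e, ArthursKelly.IsPositionNoise (fun X => G X Set.univ) e) ∧
      (∃ f, ArthursKelly.IsMomentumNoise (fun Y => G Set.univ Y) f) ∧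
      ∀ e f : MeasureTheory.Measure ℝ,
        ArthursKelly.IsPositionNoise (fun X => G X Set.univ) e →
        ArthursKelly.IsMomentumNoise (fun Y => G Set.univ Y) f →
        1 / 4 ≤ ProbabilityTheory.evariance id e * ProbabilityTheory.evariance id f ∧
        1 / 4 ≤ ArthursKelly.secondMoment e * ArthursKelly.secondMoment f ∧
        ArthursKelly.observableError (fun X => G X Set.univ) ArthursKelly.idealPosition ^ 2
          = ArthursKelly.secondMoment e ∧
        ArthursKelly.observableError (fun Y => G Set.univ Y) ArthursKelly.idealMomentum ^ 2
          = ArthursKelly.secondMoment f ∧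
        1 / 2 ≤ ArthursKelly.observableError (fun X => G X Set.univ) ArthursKelly.idealPosition *
          ArthursKelly.observableError (fun Y => G Set.univ Y) ArthursKelly.idealMomentum :=
  mainTheorem3_general lam mu kap hlam.ne' hmu.ne' σ
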